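/- Let $d\ge 2$ be an integer, let $\eta>0$, $\alpha>d$, $\beta>1$. Equip the unit cube $S=(-\tfrac12,\tfrac12]^d$ with the toroidal metric $d(x,y)=\inf\{\|x-y-z\| : z\in\mathbb Z^d\}$, where $\|\cdot\|$ is the Euclidean norm. For $s>0$ let $\mathcal P_s$ be a homogeneous Poisson point process of intensity $s$ on $S$, and attach to its points independent random weights $W_x$ with $P(W_x>w)=w^{-\beta}$ for $w\ge 1$. For $r>0$ let $G(\mathcal P_s,r)$ be the random graph with vertex set $\mathcal P_s$ in which, given the points and the weights, each pair of distinct points $x,y$ is joined by an edge, independently of all other pairs, with probability $$1-\exp\left(-\frac{\eta\,W_xW_y}{(d(x,y)/r)^{\alpha}}\right).$$ Let $B(O,1)$ be the Euclidean unit ball of $\mathbb R^d$ centred at the origin and $\theta_d$ its volume. With $W$ distributed as the weights, put $$\kappa=\int_{B(O,1)}E\left[1-\exp\left(-\frac{\eta W}{|z|^{\alpha}}\right)\right]dz ,$$ and, for $\gamma>0$, $$T(\gamma)=1-\exp\left\{-\eta\left(1+\left(\frac{\kappa}{\gamma\theta_d}\right)^{1/d}\right)^{-\alpha}\right\},\qquad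 Q(\gamma)=\gamma\,T(\gamma).$$ For $s>1$ let $\hat r_s(\gamma)>0$ be given by $\hat r_s(\gamma)^d=\dfrac{\gamma\log s}{\kappa s}$. Then there is exactly one $\rho>0$ with $Q(\rho)=1$, and for every $\gamma>\rho$, $$P\big(G(\mathcal P_s,\hat r_s(\gamma))\text{ is connected}\big)\to 1\qquad\text{as } s\to\infty .$$ -/

import Mathlib

open MeasureTheory ProbabilityTheory Filter Topology Set
open scoped NNReal ENNReal

namespace RandomConnection

noncomputable section

/-- The unit cube `(-1/2, 1/2]^d`. -/
def unitCube (d : ℕ) : Set (EuclideanSpace ℝ (Fin d)) :=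
  {x | ∀ i, x i ∈ Ioc (-(1 / 2) : ℝ) (1 / 2)}

/-- The toroidal metric `d(x, y) = inf {‖x - y - z‖ : z ∈ ℤ^d}`, with `‖·‖` the Euclidean norm. -/
def toroidalDist {d : ℕ} (x y : EuclideanSpace ℝ (Fin d)) : ℝ :=
  ⨅ z : Fin d → ℤ, ‖x - y - WithLp.toLp 2 (fun i => (z i : ℝ))‖

lemma toroidalDist_comm {d : ℕ} (x y : EuclideanSpace ℝ (Fin d)) :
    toroidalDist x y = toroidalDist y x := by
  unfold toroidalDist
  refine (Equiv.neg (Fin d → ℤ)).iInf_congr fun z => ?_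
  rw [← norm_neg]
  congr 1
  ext i
  simp
  ring

/-- The probability `1 - exp (-η w w' / (d(x, y) / r) ^ α)` of an edge between a vertex at `x` with
weight `w` and a vertex at `y` with weight `w'`, at scale `r`. (For `x = y`, which almost surely
does not occur among distinct vertices, division by zero makes this `0`.) -/
def connectionProb {d : ℕ} (η α r : ℝ) (x : EuclideanSpace ℝ (Fin d)) (w : ℝ)
    (y : EuclideanSpace ℝ (Fin d)) (w' : ℝ) : ℝ :=
  1 - Real.exp (-(η * w * w' / (toroidalDist x y / r) ^ α))

lemma connectionProb_comm {d : ℕ} (η α r : ℝ) (x : EuclideanSpace ℝ (Fin d)) (w : ℝ)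
    (y : EuclideanSpace ℝ (Fin d)) (w' : ℝ) :
    connectionProb η α r x w y w' = connectionProb η α r y w' x w := by
  unfold connectionProb
  rw [toroidalDist_comm x y, mul_right_comm]

/-- The sample space of the model: the number `N` of vertices, the locations `X₀, X₁, …`, the
weights `W₀, W₁, …`, and for every pair of indices a variable in `[0, 1]` that decides whether the
pair is joined. The vertices are the indices below `N`. -/
abbrev Sample (d : ℕ) : Type :=
  ℕ × (ℕ → EuclideanSpace ℝ (Fin d)) × (ℕ → ℝ) × (Sym2 ℕ → unitInterval)

namespace Sample

variable {d : ℕ}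

/-- The number of vertices. -/
def size (ω : Sample d) : ℕ := ω.1

/-- The location of the `i`-th vertex. -/
def point (ω : Sample d) (i : ℕ) : EuclideanSpace ℝ (Fin d) := ω.2.1 i

/-- The weight of the `i`-th vertex. -/
def weight (ω : Sample d) (i : ℕ) : ℝ := ω.2.2.1 i

/-- The uniform variable attached to an unordered pair of vertices. -/
def coin (ω : Sample d) (e : Sym2 ℕ) : ℝ := ω.2.2.2 e

/-- The number of vertices located in `B`. -/
def count (B : Set (EuclideanSpace ℝ (Fin d))) (ω : Sample d) : ℕ :=
  {i : ℕ | i < ω.size ∧ ω.point i ∈ B}.ncard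

end Sample

/-- The random graph `G(P_s, r)`: distinct vertices `i`, `j` are joined when their uniform variable
is at most the connection probability, so that, given locations and weights, the edges are
independent and have the prescribed probabilities. -/
def graph {d : ℕ} (η α r : ℝ) (ω : Sample d) : SimpleGraph (Fin ω.size) where
  Adj i j := i ≠ j ∧ ω.coin s((i : ℕ), (j : ℕ)) ≤
    connectionProb η α r (ω.point i) (ω.weight i) (ω.point j) (ω.weight j)
  symm := ⟨fun i j h => ⟨h.1.symm, by
    rw [Sym2.eq_swap, connectionProb_comm]
    exact h.2⟩⟩
  loopless := ⟨fun _ h => h.1 rfl⟩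

/-- The uniform distribution on the unit cube, which has volume one. -/
def uniformCube (d : ℕ) : Measure (EuclideanSpace ℝ (Fin d)) := volume.restrict (unitCube d)

lemma volume_unitCube (d : ℕ) : volume (unitCube d) = 1 := by
  have h : unitCube d = (MeasurableEquiv.toLp 2 (Fin d → ℝ)).symm ⁻¹'
      (Set.pi univ fun _ => Ioc (-(1 / 2) : ℝ) (1 / 2)) := by
    ext x
    simp [unitCube]
  rw [h, (EuclideanSpace.volume_preserving_symm_measurableEquiv_toLp (Fin d)).measure_preimage
    (MeasurableSet.univ_pi fun _ => measurableSet_Ioc).nullMeasurableSet, volume_pi_pi]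
  norm_num

instance (d : ℕ) : IsProbabilityMeasure (uniformCube d) :=
  ⟨by rw [uniformCube, Measure.restrict_apply_univ, volume_unitCube]⟩

/-- The law of the weights: the Pareto distribution with `P(W > w) = w ^ (-β)` for `w ≥ 1`. -/
def weightLaw (β : ℝ) : Measure ℝ := paretoMeasure 1 β

lemma isProbabilityMeasure_weightLaw {β : ℝ} (hβ : 0 < β) : IsProbabilityMeasure (weightLaw β) :=
  isProbabilityMeasure_paretoMeasure one_pos hβ

/-- The probability measure of the model at intensity `s`: the number of vertices is Poisson with
mean `s`, the locations are independent and uniform on the unit cube, the weights are independent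
with law `weightLaw β`, the variables attached to the pairs are independent and uniform on
`[0, 1]`, and these four families are independent of each other. -/
def modelMeasure (d : ℕ) (β : ℝ) (hβ : 0 < β) (s : ℝ) : Measure (Sample d) :=
  haveI := isProbabilityMeasure_weightLaw hβ
  (poissonMeasure s.toNNReal).prod
    ((Measure.infinitePi fun _ : ℕ => uniformCube d).prod
      ((Measure.infinitePi fun _ : ℕ => weightLaw β).prod
        (Measure.infinitePi fun _ : Sym2 ℕ => (volume : Measure unitInterval))))

/-- `κ = ∫_{B(O, 1)} E[1 - exp (-η W / |z| ^ α)] dz`. -/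
def kappa (d : ℕ) (η α β : ℝ) : ℝ :=
  ∫ z in Metric.ball (0 : EuclideanSpace ℝ (Fin d)) 1,
    ∫ w, (1 - Real.exp (-(η * w / ‖z‖ ^ α))) ∂(weightLaw β)

/-- The volume `θ_d` of the unit ball of `ℝ^d`. -/
def ballVolume (d : ℕ) : ℝ := volume.real (Metric.ball (0 : EuclideanSpace ℝ (Fin d)) 1)

/-- The scale `r̂_s(γ)`, with `r̂_s(γ) ^ d = γ log s / (κ s)`. -/
def rHat (d : ℕ) (η α β γ s : ℝ) : ℝ :=
  (γ * Real.log s / (kappa d η α β * s)) ^ (1 / (d : ℝ))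

/-- `T(γ) = 1 - exp (-η (1 + (κ / (γ θ_d)) ^ (1 / d)) ^ (-α))`. -/
def T (d : ℕ) (η α β γ : ℝ) : ℝ :=
  1 - Real.exp (-(η * (1 + (kappa d η α β / (γ * ballVolume d)) ^ (1 / (d : ℝ))) ^ (-α)))

/-- `Q(γ) = γ T(γ)`. -/
def Q (d : ℕ) (η α β γ : ℝ) : ℝ := γ * T d η α β γ


lemma weightLaw_Ioi {β : ℝ} (hβ : 0 < β) {w : ℝ} (hw : 1 ≤ w) :
    weightLaw β (Ioi w) = ENNReal.ofReal (w ^ (-β)) := by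
  have hw0 : 0 < w := by linarith
  rw [weightLaw, paretoMeasure, withDensity_apply _ measurableSet_Ioi]
  rw [setLIntegral_congr_fun (g := fun x => ENNReal.ofReal (β * x ^ (-(β + 1)))) measurableSet_Ioi
    (fun x hx => by
      have : (1 : ℝ) ≤ x := hw.trans (le_of_lt hx)
      simp [paretoPDF_of_le this])]
  rw [← ofReal_integral_eq_lintegral_ofReal]
  · rw [integral_const_mul, integral_Ioi_rpow_of_lt (by linarith) hw0]
    congr 1
    rw [show -(β + 1) + 1 = -β by ring]
    field_simp
  · exact (integrableOn_Ioi_rpow_of_lt (by linarith) hw0).const_mul _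
  · refine (ae_restrict_iff' measurableSet_Ioi).2 (Eventually.of_forall fun x hx => ?_)
    have : 0 < x := hw0.trans hx
    positivity

lemma measurable_toroidalDist {d : ℕ} :
    Measurable fun p : EuclideanSpace ℝ (Fin d) × EuclideanSpace ℝ (Fin d) =>
      toroidalDist p.1 p.2 := by
  unfold toroidalDist
  refine Measurable.iInf fun z => ?_
  fun_prop

lemma measurableSet_connected {d : ℕ} (η α r : ℝ) :
    MeasurableSet {ω : Sample d | (graph η α r ω).Connected} := by
  classical
  have hadj : ∀ i j : ℕ, MeasurableSet {ω : Sample d | i ≠ j ∧ ω.coin s(i, j) ≤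
      connectionProb η α r (ω.point i) (ω.weight i) (ω.point j) (ω.weight j)} := by
    intro i j
    refine MeasurableSet.inter (s₁ := {_ω : Sample d | i ≠ j}) (MeasurableSet.const _)
      (measurableSet_le (f := fun ω : Sample d => ω.coin s(i, j)) ?_ ?_)
    · unfold Sample.coin
      fun_prop
    · have h1 : Measurable fun ω : Sample d => toroidalDist (ω.point i) (ω.point j) :=
        measurable_toroidalDist.comp (f := fun ω : Sample d => (ω.point i, ω.point j)) (by
          unfold Sample.point
          fun_prop)
      have h2 : Measurable fun ω : Sample d => ω.weight i := by unfold Sample.weight; fun_prop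
      have h3 : Measurable fun ω : Sample d => ω.weight j := by unfold Sample.weight; fun_prop
      unfold connectionProb
      fun_prop
  have key : {ω : Sample d | (graph η α r ω).Connected} =
      ⋃ n : ℕ, ⋃ G ∈ {G : SimpleGraph (Fin n) | G.Connected},
        {ω : Sample d | ω.size = n} ∩ ⋂ i : Fin n, ⋂ j : Fin n,
          {ω : Sample d | ((i : ℕ) ≠ j ∧ ω.coin s((i : ℕ), (j : ℕ)) ≤
            connectionProb η α r (ω.point i) (ω.weight i) (ω.point j) (ω.weight j)) ↔
              G.Adj i j} := by
    ext ω
    simp only [mem_ofPred_eq, mem_iUnion, mem_inter_iff, mem_iInter, exists_prop]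
    constructor
    · intro h
      refine ⟨ω.size, graph η α r ω, h, rfl, fun i j => ?_⟩
      simp [graph, Fin.ext_iff]
    · rintro ⟨n, G, hG, hn, h⟩
      subst hn
      have : graph η α r ω = G := by
        ext i j
        rw [← h i j]
        simp [graph, Fin.ext_iff]
      rwa [this]
  rw [key]
  refine MeasurableSet.iUnion fun n => MeasurableSet.biUnion (Set.to_countable _) fun G _ => ?_
  refine MeasurableSet.inter ?_ (MeasurableSet.iInter fun i => MeasurableSet.iInter fun j => ?_)
  · exact measurable_fst (MeasurableSet.of_discrete (s := ({n} : Set ℕ)))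
  · exact MeasurableSet.iff (hadj i j) (MeasurableSet.const _)

/-- The points counted by `c` form a Poisson process with intensity measure `Λ`: the number of
points in a measurable set `B` is Poisson with mean `Λ B`, and the numbers of points in disjoint
measurable sets are independent. -/
structure IsPoissonProcess {Ω E : Type*} [MeasurableSpace Ω] [MeasurableSpace E]
    (c : Set E → Ω → ℕ) (Λ : Measure E) (P : Measure Ω) : Prop where
  law : ∀ B, MeasurableSet B → HasLaw (c B) (poissonMeasure (Λ B).toNNReal) P
  indep : ∀ (m : ℕ) (B : Fin m → Set E), (∀ j, MeasurableSet (B j)) →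
    Pairwise (fun j k => Disjoint (B j) (B k)) → iIndepFun (fun j => c (B j)) P

lemma Sample.count_eq_sum {d : ℕ} (B : Set (EuclideanSpace ℝ (Fin d))) (ω : Sample d) :
    (ω.count B : ℝ) = ∑ i ∈ Finset.range ω.size, B.indicator (fun _ => (1 : ℝ)) (ω.point i) := by
  classical
  have : {i : ℕ | i < ω.size ∧ ω.point i ∈ B} =
      ↑((Finset.range ω.size).filter fun i => ω.point i ∈ B) := by
    ext i; simp
  rw [Sample.count, this, ncard_coe_finset, Finset.card_filter]
  push_cast
  simp [indicator_apply]

lemma Sample.measurable_count {d : ℕ} {B : Set (EuclideanSpace ℝ (Fin d))}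
    (hB : MeasurableSet B) : Measurable (Sample.count B) := by
  classical
  have : Sample.count B = fun ω : Sample d =>
      (fun p : ℕ × (ℕ → EuclideanSpace ℝ (Fin d)) =>
        ∑ i ∈ Finset.range p.1, B.indicator (fun _ => (1 : ℕ)) (p.2 i)) (ω.1, ω.2.1) := by
    ext ω
    have := Sample.count_eq_sum B ω
    have h2 : (∑ i ∈ Finset.range ω.size, B.indicator (fun _ => (1 : ℝ)) (ω.point i)) =
      ((∑ i ∈ Finset.range ω.size, B.indicator (fun _ => (1 : ℕ)) (ω.point i) : ℕ) : ℝ) := by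
      push_cast
      refine Finset.sum_congr rfl fun i _ => ?_
      simp [indicator_apply]
    rw [h2] at this
    exact_mod_cast this
  rw [this]
  suffices hm : Measurable (fun p : ℕ × (ℕ → EuclideanSpace ℝ (Fin d)) =>
      ∑ i ∈ Finset.range p.1, B.indicator (fun _ => (1 : ℕ)) (p.2 i)) from
    hm.comp (measurable_fst.prodMk measurable_snd.fst)
  refine measurable_from_prod_countable_right fun n => ?_
  refine Finset.measurable_sum (Finset.range n) fun i _ => ?_
  exact (measurable_const.indicator hB).comp (measurable_pi_apply i)

instance (d : ℕ) (β : ℝ) (hβ : 0 < β) (s : ℝ) : IsProbabilityMeasure (modelMeasure d β hβ s) := by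
  have := isProbabilityMeasure_weightLaw hβ
  unfold modelMeasure
  infer_instance

lemma integral_prod_points {d : ℕ} (β : ℝ) (hβ : 0 < β) (s : ℝ)
    (f : EuclideanSpace ℝ (Fin d) → ℂ) (hf : Measurable f) (hb : ∀ x, ‖f x‖ ≤ 1) :
    ∫ ω : Sample d, ∏ i ∈ Finset.range ω.size, f (ω.point i) ∂(modelMeasure d β hβ s) =
      Complex.exp ((s.toNNReal : ℂ) * (∫ x, f x ∂(uniformCube d) - 1)) := by
  have := isProbabilityMeasure_weightLaw hβ
  set q := ∫ x, f x ∂(uniformCube d)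
  have hm : Measurable fun p : ℕ × (ℕ → EuclideanSpace ℝ (Fin d)) =>
      ∏ i ∈ Finset.range p.1, f (p.2 i) := by
    refine measurable_from_prod_countable_right fun n => ?_
    exact Finset.measurable_prod (Finset.range n) fun i _ => hf.comp (measurable_pi_apply i)
  have hm' : Measurable fun ω : Sample d => ∏ i ∈ Finset.range ω.size, f (ω.point i) :=
    hm.comp (f := fun ω : Sample d => (ω.1, ω.2.1)) (by fun_prop)
  have hint : Integrable (fun ω : Sample d => ∏ i ∈ Finset.range ω.size, f (ω.point i))
      (modelMeasure d β hβ s) := by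
    refine Integrable.of_bound hm'.aestronglyMeasurable 1 (Eventually.of_forall fun ω => ?_)
    rw [norm_prod]
    exact Finset.prod_le_one (fun _ _ => norm_nonneg _) fun _ _ => hb _
  unfold modelMeasure at hint ⊢
  rw [integral_prod _ hint]
  have inner : ∀ n : ℕ, ∫ y : (ℕ → EuclideanSpace ℝ (Fin d)) × (ℕ → ℝ) × (Sym2 ℕ → unitInterval),
      ∏ i ∈ Finset.range (Sample.size (n, y)), f (Sample.point (n, y) i)
        ∂((Measure.infinitePi fun _ : ℕ => uniformCube d).prod
          ((Measure.infinitePi fun _ : ℕ => weightLaw β).prod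
          (Measure.infinitePi fun _ : Sym2 ℕ => (volume : Measure unitInterval)))) = q ^ n := by
    intro n
    have := integral_fun_fst (μ := Measure.infinitePi fun _ : ℕ => uniformCube d)
      (ν := (Measure.infinitePi fun _ : ℕ => weightLaw β).prod
          (Measure.infinitePi fun _ : Sym2 ℕ => (volume : Measure unitInterval)))
      (fun X : ℕ → EuclideanSpace ℝ (Fin d) => ∏ i ∈ Finset.range n, f (X i))
    simp only [Sample.size, Sample.point]
    rw [this, probReal_univ, one_smul]
    have h2 := integral_restrict_infinitePi (s := Finset.range n) (fun _ : ℕ => uniformCube d)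
      (f := fun X => ∏ i : Finset.range n, f (X i)) (by
        refine Measurable.aestronglyMeasurable ?_
        exact Finset.measurable_prod _ fun i _ => hf.comp (measurable_pi_apply i))
    have h3 := integral_fintype_prod_eq_pow (ι := Finset.range n) (μ := uniformCube d) f
    rw [h3] at h2
    simp only [Fintype.card_coe, Finset.card_range] at h2
    rw [← h2]
    refine integral_congr_ae (Eventually.of_forall fun X => ?_)
    exact (Finset.prod_coe_sort (Finset.range n) fun i => f (X i)).symm
  simp_rw [inner]
  rw [integral_poissonMeasure' (by
    refine Integrable.of_bound (by fun_prop) 1 (Eventually.of_forall fun n => ?_)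
    rw [norm_pow]
    refine pow_le_one₀ (norm_nonneg _) ?_
    refine (norm_integral_le_of_norm_le_const (Eventually.of_forall hb)).trans ?_
    simp)]
  have hexp := NormedSpace.expSeries_div_hasSum_exp ((s.toNNReal : ℂ) * q)
  rw [← Complex.exp_eq_exp_ℂ] at hexp
  rw [mul_sub, mul_one, sub_eq_add_neg, Complex.exp_add, ← hexp.tsum_eq, ← tsum_mul_right]
  refine tsum_congr fun n => ?_
  simp [Complex.real_smul, mul_pow]
  ring

lemma integral_exp_indicator {d : ℕ} {ι : Type*} [Fintype ι]
    (B : ι → Set (EuclideanSpace ℝ (Fin d))) (hB : ∀ j, MeasurableSet (B j))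
    (hd : Pairwise fun j k => Disjoint (B j) (B k)) (t : ι → ℝ) :
    ∫ x, Complex.exp (∑ j, (t j : ℂ) * ((B j).indicator (fun _ => (1 : ℝ)) x : ℝ) * Complex.I)
        ∂(uniformCube d) - 1 =
      ∑ j, ((uniformCube d (B j)).toNNReal : ℂ) * (Complex.exp (t j * Complex.I) - 1) := by
  classical
  have h : ∀ x, Complex.exp (∑ j, (t j : ℂ) * ((B j).indicator (fun _ => (1 : ℝ)) x : ℝ) * Complex.I) =
      1 + ∑ j, (B j).indicator (fun _ => Complex.exp (t j * Complex.I) - 1) x := by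
    intro x
    by_cases hx : ∃ j, x ∈ B j
    · obtain ⟨j, hj⟩ := hx
      have hk : ∀ k, k ≠ j → x ∉ B k := fun k hkj hk => (disjoint_left.1 (hd hkj) hk hj)
      rw [Finset.sum_eq_single j (by intro k _ hkj; simp [hk k hkj]) (by simp),
        Finset.sum_eq_single j (by intro k _ hkj; simp [hk k hkj]) (by simp)]
      simp [hj]
    · push Not at hx
      simp [hx]
  simp_rw [h]
  rw [integral_add (integrable_const _) (integrable_finsetSum _ fun j _ =>
    (integrable_const _).indicator (hB j)), integral_finsetSum _ fun j _ =>
    (integrable_const _).indicator (hB j)]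
  simp only [integral_const, probReal_univ, one_smul, add_sub_cancel_left]
  refine Finset.sum_congr rfl fun j _ => ?_
  rw [integral_indicator (hB j), integral_const, measureReal_restrict_apply_univ, 
    Complex.real_smul]
  rfl

/-- Joint characteristic function of the numbers of points in disjoint sets. -/
lemma integral_exp_count {d : ℕ} (β : ℝ) (hβ : 0 < β) (s : ℝ) {ι : Type*} [Fintype ι]
    (B : ι → Set (EuclideanSpace ℝ (Fin d))) (hB : ∀ j, MeasurableSet (B j))
    (hd : Pairwise fun j k => Disjoint (B j) (B k)) (t : ι → ℝ) :
    ∫ ω : Sample d, Complex.exp (∑ j, (t j : ℂ) * (ω.count (B j) : ℝ) * Complex.I)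
        ∂(modelMeasure d β hβ s) =
      ∏ j, Complex.exp (((s.toNNReal * (uniformCube d (B j)).toNNReal : ℝ≥0) : ℂ) *
        (Complex.exp (t j * Complex.I) - 1)) := by
  have h := integral_prod_points β hβ s
    (fun x => Complex.exp (∑ j, (t j : ℂ) * ((B j).indicator (fun _ => (1 : ℝ)) x : ℝ) * Complex.I))
    (by
      refine Complex.measurable_exp.comp (Finset.measurable_sum _ fun j _ => ?_)
      exact (measurable_const.mul (Complex.measurable_ofReal.comp
        (measurable_const.indicator (hB j)))).mul measurable_const)
    (fun x => by
      rw [← Finset.sum_mul]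
      have : (∑ j, (t j : ℂ) * ((B j).indicator (fun _ => (1 : ℝ)) x : ℝ)) =
        ((∑ j, t j * (B j).indicator (fun _ => (1 : ℝ)) x : ℝ) : ℂ) := by push_cast; rfl
      rw [this, Complex.norm_exp_ofReal_mul_I])
  rw [integral_exp_indicator B hB hd t] at h
  rw [← Complex.exp_sum]
  simp_rw [NNReal.coe_mul, Complex.ofReal_mul, mul_assoc ((s.toNNReal : ℝ) : ℂ),
    ← Finset.mul_sum]
  rw [← h]
  refine integral_congr_ae (Eventually.of_forall fun ω => ?_)
  simp only
  rw [← Complex.exp_sum, Finset.sum_comm]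
  congr 1
  refine Finset.sum_congr rfl fun j _ => ?_
  have := Sample.count_eq_sum (B j) ω
  rw [this]
  push_cast
  rw [Finset.mul_sum, Finset.sum_mul]

/-- The vertex locations form a homogeneous Poisson process of intensity `s` on the unit cube. -/
theorem isPoissonProcess_points (d : ℕ) (β : ℝ) (hβ : 0 < β) (s : ℝ) :
    IsPoissonProcess (Sample.count (d := d)) (s.toNNReal • volume.restrict (unitCube d))
      (modelMeasure d β hβ s) := by
  have hcast : MeasurableEmbedding (Nat.cast : ℕ → ℝ) := by
    exact Nat.isClosedEmbedding_coe_real.measurableEmbedding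
  have hmean : ∀ B : Set (EuclideanSpace ℝ (Fin d)),
      ((s.toNNReal • volume.restrict (unitCube d)) B).toNNReal =
        s.toNNReal * (uniformCube d B).toNNReal := by
    intro B
    rw [Measure.smul_apply, ENNReal.smul_def, smul_eq_mul, ENNReal.toNNReal_mul,
      ENNReal.toNNReal_coe, uniformCube]
  have hlaw : ∀ B : Set (EuclideanSpace ℝ (Fin d)), MeasurableSet B → ∀ t : ℝ,
      charFun ((modelMeasure d β hβ s).map fun ω => (ω.count B : ℝ)) t =
        Complex.exp (((s.toNNReal * (uniformCube d B).toNNReal : ℝ≥0) : ℂ) *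
          (Complex.exp (t * Complex.I) - 1)) := by
    intro B hB t
    have h := integral_exp_count β hβ s (fun _ : Fin 1 => B) (fun _ => hB)
      (fun i j hij => (hij (Subsingleton.elim i j)).elim) (fun _ => t)
    rw [charFun_apply_real, integral_map
      (by exact (hcast.measurable.comp (Sample.measurable_count hB)).aemeasurable) (by fun_prop)]
    rw [Fin.prod_univ_one] at h
    rw [← h]
    simp_rw [Fin.sum_univ_one]
  refine ⟨fun B hB => ⟨(Sample.measurable_count hB).aemeasurable, ?_⟩, fun m B hB hd => ?_⟩
  · have h : ((modelMeasure d β hβ s).map (Sample.count B)).map (Nat.cast : ℕ → ℝ) =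
        (poissonMeasure (s.toNNReal * (uniformCube d B).toNNReal)).map (Nat.cast : ℕ → ℝ) := by
      have := Measure.isProbabilityMeasure_map (μ := modelMeasure d β hβ s)
        (Sample.measurable_count hB).aemeasurable
      have := Measure.isProbabilityMeasure_map (μ := (modelMeasure d β hβ s).map (Sample.count B))
        hcast.measurable.aemeasurable
      refine Measure.ext_of_charFun (funext fun t => ?_)
      rw [charFun_map_cast_poissonMeasure, Measure.map_map hcast.measurable
        (Sample.measurable_count hB)]
      exact hlaw B hB t
    rw [hmean]
    ext A hA
    have := congrArg (fun ν => ν ((Nat.cast : ℕ → ℝ) '' A)) h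
    simpa [hcast.map_apply, preimage_image_eq _ Nat.cast_injective] using this
  · have hr : iIndepFun (fun j ω => (ω.count (B j) : ℝ)) (modelMeasure d β hβ s) := by
      rw [iIndepFun_iff_charFun_pi
        (X := fun j (ω : Sample d) => (ω.count (B j) : ℝ))
        (fun j => (hcast.measurable.comp (Sample.measurable_count (hB j))).aemeasurable)]
      intro t
      simp_rw [fun j => hlaw (B j) (hB j) (t j)]
      rw [← integral_exp_count β hβ s B hB hd, charFun_apply, integral_map
        (by
          refine Measurable.aemeasurable ?_
          refine (WithLp.measurable_toLp 2 _).comp (measurable_pi_lambda _ fun j => ?_)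
          exact hcast.measurable.comp (Sample.measurable_count (hB j))) (by fun_prop)]
      refine integral_congr_ae (Eventually.of_forall fun ω => ?_)
      simp [PiLp.inner_apply, Finset.sum_mul]
    have hf : Measurable (fun x : ℝ => ⌊x⌋₊) := Nat.measurable_floor
    have := hr.comp (fun _ x => ⌊x⌋₊) fun _ => hf
    refine this.congr fun j => Eventually.of_forall fun ω => ?_
    simp

end
end RandomConnection

/-! Since `T` takes values below one, `Q ρ = 1` forces `ρ > 1`, so it is enough to prove
connectivity for every `γ > 1`. There, edges of length of order `r = rHat` already connect the
graph. Write `L = log s`.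

Weights are at least one, so a vertex is joined to a uniform random vertex within distance `r` with
probability at least `κ r ^ d`; hence its mean number of short-range neighbours is at least about `s
κ r ^ d = γ L`. An exponential Markov bound (`measure_few_nbrs_le`) shows that, for small `δ`, a
given vertex has at most `δ L` such neighbours with probability at most a constant times `s ^ (-1 -
(γ - 1) / 4)`. As `γ > 1`, this survives a sum over about `s` vertices.

Two vertices within `D r` of each other that both have `m ≥ δ L` neighbours are joined directly,
through a common neighbour, or through one of at least `m * m` pairs of neighbours. Each such pair
lies within `(D + 2) r`, so it fails to be an edge with probability bounded away from one,
independently of the others. The failure probability `exp (-c L ^ 2)` beats the roughly `s ^ 2`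
pairs of vertices (`measure_separatedEvent_le`).

Finally, a grid whose cells have side of order `r` and mean occupancy at least `2 L` has no empty
cell with high probability. Points of adjacent cells are within `D r`, hence in one component, and
walking through the grid connects everything (`connected_of_occupied_cells`). These bounds are
proved for a fixed number `n` of vertices and then averaged over the Poisson law. -/

namespace RandomConnection

noncomputable section

/-! ### Independence in infinite product measures. -/

section InfiniteProducts

variable {ι X : Type*} [MeasurableSpace X]

/-- The integral of a product of functions of distinct coordinates under a product measure. -/
lemma lintegral_finset_prod_infinitePi {τ : Type*} (μ : ι → Measure X)
    [∀ i, IsProbabilityMeasure (μ i)] (e : τ → ι) (he : Function.Injective e)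
    (S : Finset τ) (g : τ → X → ℝ≥0∞) (hg : ∀ t, Measurable (g t)) :
    ∫⁻ x, ∏ t ∈ S, g t (x (e t)) ∂(Measure.infinitePi μ) = ∏ t ∈ S, ∫⁻ a, g t a ∂(μ (e t)) := by
  have hind : iIndepFun (fun (t : τ) (x : ι → X) => g t (x (e t))) (Measure.infinitePi μ) :=
    ((iIndepFun_infinitePi (P := μ) (X := fun _ x => x) (fun _ => measurable_id)).precomp
      he).comp g hg
  have h := lintegral_prod_eq_prod_lintegral_of_indepFun S
    (fun (t : τ) (x : ι → X) => g t (x (e t))) hind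
    (fun t => (hg t).comp (measurable_pi_apply _))
  rw [h]
  refine Finset.prod_congr rfl fun t _ => ?_
  exact (measurePreserving_eval_infinitePi μ (e t)).lintegral_comp (hg t)

/-- Splicing two independent samples of a product measure along a set of coordinates gives again a
sample of the product measure. -/
lemma measurePreserving_splice (μ : ι → Measure X) [∀ i, IsProbabilityMeasure (μ i)]
    (K : ι → Prop) [DecidablePred K] :
    MeasurePreserving (fun (p : (ι → X) × (ι → X)) k => if K k then p.1 k else p.2 k)
      ((Measure.infinitePi μ).prod (Measure.infinitePi μ)) (Measure.infinitePi μ) := by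
  have hm : Measurable (fun (p : (ι → X) × (ι → X)) k => if K k then p.1 k else p.2 k) := by
    refine measurable_pi_lambda _ fun k => ?_
    by_cases hk : K k
    · simp only [hk, if_true]; fun_prop
    · simp only [hk, if_false]; fun_prop
  refine ⟨hm, Measure.eq_infinitePi μ fun s t ht => ?_⟩
  rw [Measure.map_apply hm (MeasurableSet.pi s.countable_toSet fun i _ => ht i)]
  -- The preimage of a box is a product of two boxes, one constraining the coordinates in `K` and
  -- the other the remaining ones.
  have : (fun (p : (ι → X) × (ι → X)) k => if K k then p.1 k else p.2 k) ⁻¹' (Set.pi s t) =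
      (Set.pi (s.filter K) t) ×ˢ (Set.pi (s.filter fun k => ¬ K k) t) := by
    ext p
    simp only [mem_preimage, Set.mem_pi, mem_prod, Finset.coe_filter, mem_ofPred_eq]
    constructor
    · exact fun h => ⟨fun i hi => by simpa [hi.2] using h i hi.1,
        fun i hi => by simpa [hi.2] using h i hi.1⟩
    · intro h i hi
      by_cases hk : K i
      · simpa [hk] using h.1 i ⟨hi, hk⟩
      · simpa [hk] using h.2 i ⟨hi, hk⟩
  rw [this, Measure.prod_prod, Measure.infinitePi_pi μ (fun i _ => ht i),
    Measure.infinitePi_pi μ (fun i _ => ht i), Finset.prod_filter_mul_prod_filter_not]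

/-- The integral of a product of functions of pairs of coordinates with a common first entry. -/
lemma lintegral_pivot_prod_infinitePi [DecidableEq ι] (μ : ι → Measure X)
    [∀ i, IsProbabilityMeasure (μ i)]
    (i : ι) (S : Finset ι) (hi : i ∉ S) (φ : X → ℝ≥0∞) (hφ : Measurable φ)
    (g : ι → X → X → ℝ≥0∞) (hg : ∀ j, Measurable (Function.uncurry (g j))) :
    ∫⁻ x, φ (x i) * ∏ j ∈ S, g j (x i) (x j) ∂(Measure.infinitePi μ) =
      ∫⁻ a, φ a * ∏ j ∈ S, ∫⁻ b, g j a b ∂(μ j) ∂(μ i) := by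
  have hF : Measurable fun x : ι → X => φ (x i) * ∏ j ∈ S, g j (x i) (x j) := by
    refine (hφ.comp (measurable_pi_apply i)).mul (Finset.measurable_prod S fun j _ => ?_)
    exact (hg j).comp (f := fun x : ι → X => (x i, x j)) (by fun_prop)
  have hG : Measurable fun a => φ a * ∏ j ∈ S, ∫⁻ b, g j a b ∂(μ j) := by
    refine hφ.mul (Finset.measurable_prod S fun j _ => ?_)
    exact (hg j).lintegral_prod_right'
  -- Coordinate `i` is taken from one sample and all others from an independent copy. With the first
  -- sample frozen, the product factorises over `S`, which does not contain `i`.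
  have h := measurePreserving_splice μ (fun k => k = i)
  have h1 := lintegral_prod (μ := Measure.infinitePi μ) (ν := Measure.infinitePi μ) _
    (hF.comp h.measurable).aemeasurable
  refine (h.lintegral_comp hF).symm.trans (h1.trans ?_)
  rw [← (measurePreserving_eval_infinitePi μ i).lintegral_comp hG]
  refine lintegral_congr fun x => ?_
  simp only [Function.comp_apply]
  have hS : ∀ j ∈ S, j ≠ i := fun j hj h => hi (h ▸ hj)
  have : ∀ y : ι → X, φ (x i) * ∏ j ∈ S, g j (x i) (if j = i then x j else y j) =
      φ (x i) * ∏ j ∈ S, g j (x i) (y j) := by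
    intro y
    congr 1
    exact Finset.prod_congr rfl fun j hj => by rw [if_neg (hS j hj)]
  simp only [if_true, this]
  have hm : Measurable fun y : ι → X => ∏ j ∈ S, g j (x i) (y j) :=
    Finset.measurable_prod S fun j _ =>
      (hg j).comp (f := fun y : ι → X => (x i, y j)) (by fun_prop)
  rw [lintegral_const_mul _ hm]
  congr 1
  exact lintegral_finset_prod_infinitePi μ id Function.injective_id S (fun j => g j (x i))
    fun j => (hg j).of_uncurry_left

lemma measurableSet_filter_eq {Ω T : Type*} [MeasurableSpace Ω] (R F : Finset T)
    (P : T → Ω → Prop) [∀ ω, DecidablePred fun t => P t ω] (hP : ∀ t, MeasurableSet {ω | P t ω}) :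
    MeasurableSet {ω | R.filter (fun t => P t ω) = F} := by
  classical
  have : {ω | R.filter (fun t => P t ω) = F} =
      {_ω | F ⊆ R} ∩ ⋂ t ∈ R, {ω | P t ω ↔ t ∈ F} := by
    ext ω
    simp only [mem_ofPred_eq, mem_inter_iff, mem_iInter]
    constructor
    · rintro rfl
      exact ⟨Finset.filter_subset _ _, fun t ht => by simp [ht]⟩
    · rintro ⟨h1, h2⟩
      ext t
      rw [Finset.mem_filter]
      exact ⟨fun h => (h2 t h.1).1 h.2, fun h => ⟨h1 h, (h2 t (h1 h)).2 h⟩⟩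
  rw [this]
  exact (MeasurableSet.const _).inter (MeasurableSet.biInter R.countable_toSet fun t _ =>
    MeasurableSet.iff (hP t) (MeasurableSet.const _))

/-- Two random finite sets, obtained by filtering, are disjoint, of size at least `m` and without
any link between them: this is an event. -/
lemma measurableSet_separated {Ω : Type*} [MeasurableSpace Ω] (m : ℕ) (R R' : Finset ℕ)
    (P P' : ℕ → Ω → Prop) [∀ ω, DecidablePred fun t => P t ω] [∀ ω, DecidablePred fun t => P' t ω]
    (L : ℕ → ℕ → Ω → Prop)
    (hP : ∀ t, MeasurableSet {ω | P t ω}) (hP' : ∀ t, MeasurableSet {ω | P' t ω})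
    (hL : ∀ t t', MeasurableSet {ω | L t t' ω}) :
    MeasurableSet {ω | m ≤ (R.filter fun t => P t ω).card ∧ m ≤ (R'.filter fun t => P' t ω).card ∧
      Disjoint (R.filter fun t => P t ω) (R'.filter fun t => P' t ω) ∧
      ∀ k ∈ R.filter (fun t => P t ω), ∀ l ∈ R'.filter (fun t => P' t ω), L k l ω} := by
  have : {ω | m ≤ (R.filter fun t => P t ω).card ∧ m ≤ (R'.filter fun t => P' t ω).card ∧
      Disjoint (R.filter fun t => P t ω) (R'.filter fun t => P' t ω) ∧
      ∀ k ∈ R.filter (fun t => P t ω), ∀ l ∈ R'.filter (fun t => P' t ω), L k l ω} =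
      ⋃ A : Finset ℕ, ⋃ B : Finset ℕ, {ω | R.filter (fun t => P t ω) = A} ∩
        {ω | R'.filter (fun t => P' t ω) = B} ∩ {_ω | m ≤ A.card ∧ m ≤ B.card ∧ Disjoint A B} ∩
        ⋂ k ∈ A, ⋂ l ∈ B, {ω | L k l ω} := by
    ext ω
    simp only [mem_ofPred_eq, mem_iUnion, mem_inter_iff, mem_iInter]
    constructor
    · exact fun h => ⟨_, _, ⟨⟨rfl, rfl⟩, h.1, h.2.1, h.2.2.1⟩, h.2.2.2⟩
    · rintro ⟨A, B, ⟨⟨rfl, rfl⟩, h1, h2, h3⟩, h4⟩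
      exact ⟨h1, h2, h3, h4⟩
  rw [this]
  refine MeasurableSet.iUnion fun A => MeasurableSet.iUnion fun B => ?_
  refine (((measurableSet_filter_eq R A P hP).inter (measurableSet_filter_eq R' B P' hP')).inter
    (MeasurableSet.const _)).inter ?_
  exact MeasurableSet.biInter A.countable_toSet fun k _ =>
    MeasurableSet.biInter B.countable_toSet fun l _ => hL k l

/-- Bond percolation with edge thresholds `c`: disjoint neighbourhoods of size at least `m` of two
vertices are joined by an edge except with probability at most `(1 - p) ^ (m * m)`. -/
lemma percolation_separated_le (m i j : ℕ) (c : Sym2 ℕ → ℝ) (p : ℝ) (R R' : Finset ℕ)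
    (hiR : i ∉ R) (hjR : j ∉ R) (hiR' : i ∉ R') (hjR' : j ∉ R')
    (hc : ∀ k ∈ R, ∀ l ∈ R', k ≠ l → p ≤ c s(k, l)) (hp0 : 0 ≤ p) :
    Measure.infinitePi (fun _ : Sym2 ℕ => (volume : Measure unitInterval))
      {u | m ≤ (R.filter fun k => (u s(i, k) : ℝ) ≤ c s(i, k)).card ∧
        m ≤ (R'.filter fun k => (u s(j, k) : ℝ) ≤ c s(j, k)).card ∧
        Disjoint (R.filter fun k => (u s(i, k) : ℝ) ≤ c s(i, k))
          (R'.filter fun k => (u s(j, k) : ℝ) ≤ c s(j, k)) ∧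
        ∀ k ∈ R.filter (fun k => (u s(i, k) : ℝ) ≤ c s(i, k)),
          ∀ l ∈ R'.filter (fun k => (u s(j, k) : ℝ) ≤ c s(j, k)), c s(k, l) < (u s(k, l) : ℝ)} ≤
      ENNReal.ofReal (1 - p) ^ (m * m) := by
  classical
  have hu : ∀ e : Sym2 ℕ, Measurable fun u : Sym2 ℕ → unitInterval => (u e : ℝ) := fun e =>
    measurable_subtype_coe.comp (measurable_pi_apply e)
  have hS := measurableSet_separated (Ω := Sym2 ℕ → unitInterval) m R R'
    (fun k u => (u s(i, k) : ℝ) ≤ c s(i, k)) (fun k u => (u s(j, k) : ℝ) ≤ c s(j, k))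
    (fun k l u => c s(k, l) < (u s(k, l) : ℝ))
    (fun k => measurableSet_le (hu _) measurable_const)
    (fun k => measurableSet_le (hu _) measurable_const)
    (fun k l => measurableSet_lt measurable_const (hu _))
  set ν := Measure.infinitePi (fun _ : Sym2 ℕ => (volume : Measure unitInterval))
  -- Resample the variables of all edges that avoid `i` and `j`. The old sample determines the
  -- neighbourhoods `A` and `B`, while the edges between them use only fresh variables, since `i`
  -- and `j` lie in neither `R` nor `R'`.
  have h := measurePreserving_splice (fun _ : Sym2 ℕ => (volume : Measure unitInterval))
    (fun e => i ∈ e ∨ j ∈ e)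
  rw [← h.measure_preimage hS.nullMeasurableSet, Measure.prod_apply (h.measurable hS)]
  refine (lintegral_mono (g := fun _ => ENNReal.ofReal (1 - p) ^ (m * m)) fun u => ?_).trans
    (by simp)
  set A := R.filter fun k => (u s(i, k) : ℝ) ≤ c s(i, k)
  set B := R'.filter fun k => (u s(j, k) : ℝ) ≤ c s(j, k)
  by_cases hAB : m ≤ A.card ∧ m ≤ B.card ∧ Disjoint A B
  swap
  · refine le_of_eq_of_le ?_ zero_le
    convert measure_empty (μ := ν)
    ext u'
    simp only [mem_preimage, mem_ofPred_eq, Sym2.mem_iff, true_or, or_true, if_true,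
      mem_empty_iff_false, iff_false]
    exact fun h' => hAB ⟨h'.1, h'.2.1, h'.2.2.1⟩
  obtain ⟨hmA, hmB, hdis⟩ := hAB
  -- Disjointness of `A` and `B` excludes counting an unordered pair twice, so at least `m * m`
  -- distinct variables are involved.
  have hinj : Set.InjOn (fun q : ℕ × ℕ => s(q.1, q.2)) (A ×ˢ B : Finset (ℕ × ℕ)) := by
    rintro ⟨k, l⟩ hkl ⟨k', l'⟩ hkl' heq
    simp only [Finset.coe_product, mem_prod, Finset.mem_coe] at hkl hkl'
    rcases Sym2.eq_iff.1 heq with ⟨h1, h2⟩ | ⟨h1, h2⟩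
    · exact Prod.ext h1 h2
    · have h1 : k = l' := h1
      exact (Finset.disjoint_left.1 hdis hkl.1 (h1 ▸ hkl'.2)).elim
  set E : Finset (Sym2 ℕ) := (A ×ˢ B).image fun q : ℕ × ℕ => s(q.1, q.2) with hE
  have hcard : E.card = A.card * B.card := by
    rw [hE, Finset.card_image_of_injOn hinj, Finset.card_product]
  calc _ ≤ ν (Set.pi E fun e => {x : unitInterval | c e < (x : ℝ)}) := by
        refine measure_mono fun u' hu' => ?_
        simp only [mem_preimage, mem_ofPred_eq, Sym2.mem_iff, true_or, or_true, if_true] at hu'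
        intro e he
        obtain ⟨⟨k, l⟩, hkl, rfl⟩ := Finset.mem_image.1 (Finset.mem_coe.1 he)
        obtain ⟨hk, hl⟩ := Finset.mem_product.1 hkl
        have := hu'.2.2.2 k hk l hl
        have hk' := (Finset.mem_filter.1 hk).1
        have hl' := (Finset.mem_filter.1 hl).1
        rw [if_neg] at this
        · exact this
        · rintro ((rfl | rfl) | (rfl | rfl))
          exacts [hiR hk', hiR' hl', hjR hk', hjR' hl']
    _ = ∏ e ∈ E, volume {x : unitInterval | c e < (x : ℝ)} := by
        refine Measure.infinitePi_pi _ fun e _ => ?_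
        exact measurableSet_lt measurable_const measurable_subtype_coe
    _ ≤ ∏ e ∈ E, ENNReal.ofReal (1 - p) := by
        refine Finset.prod_le_prod' fun e he => ?_
        obtain ⟨⟨k, l⟩, hkl, rfl⟩ := Finset.mem_image.1 he
        obtain ⟨hk, hl⟩ := Finset.mem_product.1 hkl
        have hpc := hc k (Finset.mem_filter.1 hk).1 l (Finset.mem_filter.1 hl).1
          (fun hkl' => Finset.disjoint_left.1 hdis hk (hkl' ▸ hl))
        rw [unitInterval.volume_def, Measure.comap_apply _ Subtype.val_injective
          (fun s hs => measurableSet_Icc.subtype_image hs) _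
          (measurableSet_lt measurable_const measurable_subtype_coe)]
        calc _ ≤ volume (Ioc p 1) := by
              refine measure_mono ?_
              rintro _ ⟨x, hx, rfl⟩
              exact ⟨hpc.trans_lt hx, x.2.2⟩
          _ = _ := Real.volume_Ioc
    _ = ENNReal.ofReal (1 - p) ^ (A.card * B.card) := by rw [Finset.prod_const, hcard]
    _ ≤ _ := by
        refine pow_le_pow_right_of_le_one' ?_ (Nat.mul_le_mul hmA hmB)
        rw [ENNReal.ofReal_le_one]
        linarith

end InfiniteProducts

/-! ### Geometry of the torus: distance, translation invariance, integration over small balls. -/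

section Torus

variable {d : ℕ}

/-- The vectors with integer coordinates, as a homomorphism. -/
def latticeHom (d : ℕ) : (Fin d → ℤ) →+ EuclideanSpace ℝ (Fin d) where
  toFun z := WithLp.toLp 2 fun i => (z i : ℝ)
  map_zero' := by ext i; simp
  map_add' a b := by ext i; simp

@[simp] lemma latticeHom_apply (z : Fin d → ℤ) (i : Fin d) : latticeHom d z i = z i := rfl

lemma toroidalDist_eq (x y : EuclideanSpace ℝ (Fin d)) :
    toroidalDist x y = ⨅ z : Fin d → ℤ, ‖x - y - latticeHom d z‖ := rfl

lemma bddBelow_toroidalDist (x y : EuclideanSpace ℝ (Fin d)) :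
    BddBelow (range fun z : Fin d → ℤ => ‖x - y - latticeHom d z‖) :=
  ⟨0, by rintro _ ⟨z, rfl⟩; exact norm_nonneg _⟩

lemma toroidalDist_nonneg (x y : EuclideanSpace ℝ (Fin d)) : 0 ≤ toroidalDist x y :=
  Real.iInf_nonneg fun _ => norm_nonneg _

lemma toroidalDist_le (x y : EuclideanSpace ℝ (Fin d)) (z : Fin d → ℤ) :
    toroidalDist x y ≤ ‖x - y - latticeHom d z‖ :=
  ciInf_le (bddBelow_toroidalDist x y) z

lemma toroidalDist_le_norm (x y : EuclideanSpace ℝ (Fin d)) : toroidalDist x y ≤ ‖x - y‖ := by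
  simpa using toroidalDist_le x y 0

lemma exists_norm_lt_of_toroidalDist_lt {x y : EuclideanSpace ℝ (Fin d)} {t : ℝ}
    (h : toroidalDist x y < t) : ∃ z : Fin d → ℤ, ‖x - y - latticeHom d z‖ < t :=
  exists_lt_of_ciInf_lt h

lemma toroidalDist_triangle (x y z : EuclideanSpace ℝ (Fin d)) :
    toroidalDist x z ≤ toroidalDist x y + toroidalDist y z := by
  refine le_of_forall_pos_le_add fun ε hε => ?_
  obtain ⟨k, hk⟩ := exists_norm_lt_of_toroidalDist_lt (lt_add_of_pos_right (toroidalDist x y)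
    (half_pos hε))
  obtain ⟨l, hl⟩ := exists_norm_lt_of_toroidalDist_lt (lt_add_of_pos_right (toroidalDist y z)
    (half_pos hε))
  have h := toroidalDist_le x z (k + l)
  have h2 : x - z - latticeHom d (k + l) = (x - y - latticeHom d k) + (y - z - latticeHom d l) := by
    rw [map_add]; abel
  rw [h2] at h
  linarith [norm_add_le (x - y - latticeHom d k) (y - z - latticeHom d l)]

lemma one_le_norm_latticeHom {z : Fin d → ℤ} (hz : z ≠ 0) : 1 ≤ ‖latticeHom d z‖ := by
  obtain ⟨i, hi⟩ := Function.ne_iff.1 hz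
  refine le_trans ?_ (PiLp.norm_apply_le (latticeHom d z) i)
  rw [latticeHom_apply, Real.norm_eq_abs]
  exact_mod_cast Int.one_le_abs hi

/-- A nonzero lattice vector has norm at least one, so shifting a vector shorter than `1 / 2` by it
cannot shorten it. -/
lemma toroidalDist_eq_norm {x y : EuclideanSpace ℝ (Fin d)} (h : ‖x - y‖ < 1 / 2) :
    toroidalDist x y = ‖x - y‖ := by
  refine le_antisymm (toroidalDist_le_norm x y) (le_ciInf fun z => ?_)
  change ‖x - y‖ ≤ ‖x - y - latticeHom d z‖
  by_cases hz : z = 0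
  · simp [hz]
  · have h1 := one_le_norm_latticeHom hz
    have h2 := norm_sub_norm_le (latticeHom d z) (x - y)
    rw [norm_sub_rev (latticeHom d z)] at h2
    linarith

/-- Attainment of the infimum is obtained by a translation: some lattice shift brings the points
within `1 / 4`, where the toroidal distance, unchanged by the shift, is the norm. -/
lemma exists_eq_of_toroidalDist_eq_zero {x y : EuclideanSpace ℝ (Fin d)}
    (h : toroidalDist x y = 0) : ∃ z : Fin d → ℤ, y = x - latticeHom d z := by
  obtain ⟨z, hz⟩ := exists_norm_lt_of_toroidalDist_lt (x := x) (y := y) (t := 1 / 4)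
    (by rw [h]; norm_num)
  refine ⟨z, ?_⟩
  have h1 : toroidalDist (x - latticeHom d z) y ≤ 0 := by
    rw [← h]
    refine le_ciInf fun k => ?_
    have := toroidalDist_le (x - latticeHom d z) y (k - z)
    rw [map_sub] at this
    have h3 : x - latticeHom d z - y - (latticeHom d k - latticeHom d z) =
        x - y - latticeHom d k := by abel
    rw [h3] at this
    exact this
  have h2 : ‖x - latticeHom d z - y‖ < 1 / 2 := by
    rw [sub_right_comm]; linarith
  rw [toroidalDist_eq_norm h2] at h1
  exact (sub_eq_zero.1 (norm_le_zero_iff.1 h1)).symm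

lemma toroidalDist_add_lattice (x y : EuclideanSpace ℝ (Fin d)) (z : Fin d → ℤ) :
    toroidalDist x (latticeHom d z + y) = toroidalDist x y := by
  rw [toroidalDist_eq, toroidalDist_eq]
  refine (Equiv.addRight z).iInf_congr fun k => ?_
  congr 1
  simp only [Equiv.coe_addRight, map_add]
  abel

lemma toroidalDist_add_self (x y : EuclideanSpace ℝ (Fin d)) :
    toroidalDist x (x + y) = toroidalDist 0 y := by
  simp [toroidalDist_eq]

lemma measurableSet_unitCube (d : ℕ) : MeasurableSet (unitCube d) := by
  have : unitCube d = ⋂ i, {x | x i ∈ Ioc (-(1 / 2) : ℝ) (1 / 2)} := by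
    ext x; simp [unitCube]
  rw [this]
  refine MeasurableSet.iInter fun i => ?_
  have hm : Measurable fun x : EuclideanSpace ℝ (Fin d) => x i := by fun_prop
  exact hm measurableSet_Ioc

/-- Each coordinate has exactly one integer translate in a half-open interval of length one. This
gives translation invariance of the torus below. -/
lemma isAddFundamentalDomain_unitCube (d : ℕ) :
    IsAddFundamentalDomain (latticeHom d).range (unitCube d) volume := by
  refine IsAddFundamentalDomain.mk' (measurableSet_unitCube d).nullMeasurableSet fun x => ?_
  have hx := fun i => existsUnique_add_zsmul_mem_Ioc (one_pos : (0 : ℝ) < 1) (x i) (-(1 / 2))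
  choose z hz hu using hx
  refine ⟨⟨latticeHom d z, z, rfl⟩, ?_, ?_⟩
  · intro i
    have := hz i
    simp only [zsmul_eq_mul, mul_one] at this
    change (latticeHom d z + x) i ∈ _
    rw [PiLp.add_apply, latticeHom_apply, add_comm]
    norm_num at this ⊢
    exact this
  · rintro ⟨_, z', rfl⟩ h
    congr 2
    funext i
    refine hu i _ ?_
    have := h i
    change (latticeHom d z' + x) i ∈ _ at this
    rw [PiLp.add_apply, latticeHom_apply, add_comm] at this
    norm_num at this ⊢
    exact this

-- The integrand is periodic under the lattice, so the cube may be replaced by its translate by `x`,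
-- another fundamental domain; translating back moves `x` to the origin.
open Pointwise in
lemma lintegral_toroidalDist_eq (x : EuclideanSpace ℝ (Fin d)) (h : ℝ → ℝ≥0∞) :
    ∫⁻ y, h (toroidalDist x y) ∂(uniformCube d) =
      ∫⁻ y, h (toroidalDist 0 y) ∂(uniformCube d) := by
  have hF := isAddFundamentalDomain_unitCube d
  have hF' : IsAddFundamentalDomain (latticeHom d).range (x +ᵥ unitCube d) volume :=
    hF.vadd_of_comm x
  have : Countable (latticeHom d).range := (countable_range (latticeHom d)).to_subtype
  have h1 := hF.setLIntegral_eq hF' (fun y => h (toroidalDist x y)) (by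
    rintro ⟨_, z, rfl⟩ y
    change h (toroidalDist x (latticeHom d z + y)) = _
    rw [toroidalDist_add_lattice])
  rw [uniformCube, h1]
  have hmp := measurePreserving_add_left (volume : Measure (EuclideanSpace ℝ (Fin d))) x
  have hemb := (Homeomorph.addLeft x).measurableEmbedding
  have himg : x +ᵥ unitCube d = (fun y => x + y) '' unitCube d := rfl
  rw [himg]
  have h2 := hmp.setLIntegral_comp_emb hemb (fun y => h (toroidalDist x y)) (unitCube d)
  rw [← h2]
  simp_rw [toroidalDist_add_self]

lemma ball_subset_unitCube {r : ℝ} (hr : r ≤ 1 / 2) :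
    Metric.ball (0 : EuclideanSpace ℝ (Fin d)) r ⊆ unitCube d := by
  intro y hy i
  have h1 : ‖y‖ < r := by simpa using hy
  have h2 := PiLp.norm_apply_le y i
  rw [Real.norm_eq_abs] at h2
  have := abs_lt.1 (h2.trans_lt (h1.trans_le hr))
  exact ⟨this.1, this.2.le⟩

lemma toroidalDist_zero_left {r : ℝ} (hr : r ≤ 1 / 2) {y : EuclideanSpace ℝ (Fin d)}
    (hy : y ∈ Metric.ball (0 : EuclideanSpace ℝ (Fin d)) r) : toroidalDist 0 y = ‖y‖ := by
  have h1 : ‖y‖ < r := by simpa using hy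
  rw [toroidalDist_eq_norm] <;> rw [zero_sub, norm_neg]
  linarith

/-- The integral over the torus of a function of the distance, supported in a small ball. -/
lemma lintegral_ball_le_lintegral_toroidalDist (x : EuclideanSpace ℝ (Fin d)) (h : ℝ → ℝ≥0∞)
    {r : ℝ} (hr0 : 0 < r) (hr : r ≤ 1 / 2) :
    ENNReal.ofReal (r ^ d) * ∫⁻ z in Metric.ball (0 : EuclideanSpace ℝ (Fin d)) 1, h (r * ‖z‖) ≤
      ∫⁻ y, (if toroidalDist x y < r then h (toroidalDist x y) else 0) ∂(uniformCube d) := by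
  rw [lintegral_toroidalDist_eq x fun t => if t < r then h t else 0]
  calc _ = ∫⁻ z in Metric.ball (0 : EuclideanSpace ℝ (Fin d)) r, h ‖z‖ := by
        have hmap := Measure.map_addHaar_smul
          (volume : Measure (EuclideanSpace ℝ (Fin d))) hr0.ne'
        have hemb : MeasurableEmbedding fun z : EuclideanSpace ℝ (Fin d) => r • z :=
          (Homeomorph.smulOfNeZero r hr0.ne').measurableEmbedding
        have hpre : (fun z : EuclideanSpace ℝ (Fin d) => r • z) ⁻¹' Metric.ball 0 r =
            Metric.ball 0 1 := by
          ext z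
          simp [norm_smul, abs_of_pos hr0, hr0]
        have h3 := hemb.lintegral_map (fun z => h ‖z‖)
          (μ := volume.restrict ((fun z : EuclideanSpace ℝ (Fin d) => r • z) ⁻¹'
            Metric.ball (0 : EuclideanSpace ℝ (Fin d)) r))
        rw [← hemb.restrict_map, hmap, hpre, Measure.restrict_smul, lintegral_smul_measure] at h3
        simp only [norm_smul, Real.norm_eq_abs, abs_of_pos hr0] at h3
        rw [← h3, smul_eq_mul, ← mul_assoc, ← ENNReal.ofReal_mul (by positivity)]
        simp [abs_of_pos hr0, hr0.ne']
    _ = ∫⁻ y in Metric.ball (0 : EuclideanSpace ℝ (Fin d)) r,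
          (if toroidalDist 0 y < r then h (toroidalDist 0 y) else 0) := by
        refine setLIntegral_congr_fun Metric.isOpen_ball.measurableSet fun y hy => ?_
        rw [toroidalDist_zero_left hr hy, if_pos (by simpa using hy)]
    _ ≤ _ := lintegral_mono_set (ball_subset_unitCube hr)

lemma uniformCube_toroidalDist_eq_zero (hd : 0 < d) (x : EuclideanSpace ℝ (Fin d)) :
    uniformCube d {y | toroidalDist x y = 0} = 0 := by
  have : Nonempty (Fin d) := ⟨⟨0, hd⟩⟩
  have : Nontrivial (EuclideanSpace ℝ (Fin d)) := inferInstance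
  refine measure_mono_null (t := range fun z => x - latticeHom d z) ?_ ?_
  · intro y hy
    obtain ⟨z, hz⟩ := exists_eq_of_toroidalDist_eq_zero hy
    exact ⟨z, hz.symm⟩
  · exact Measure.absolutelyContinuous_of_le Measure.restrict_le_self
      ((countable_range _).measure_zero volume)

end Torus

/-! ### Configurations with infinitely many potential vertices; paths between nearby vertices. -/

section Config

/-- Locations, weights and pair variables of infinitely many potential vertices. -/
abbrev Config (d : ℕ) : Type :=
  (ℕ → EuclideanSpace ℝ (Fin d)) × (ℕ → ℝ) × (Sym2 ℕ → unitInterval)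

/-- The law of the locations, weights and pair variables. -/
def configMeasure (d : ℕ) (β : ℝ) (hβ : 0 < β) : Measure (Config d) :=
  haveI := isProbabilityMeasure_weightLaw hβ
  (Measure.infinitePi fun _ : ℕ => uniformCube d).prod
    ((Measure.infinitePi fun _ : ℕ => weightLaw β).prod
      (Measure.infinitePi fun _ : Sym2 ℕ => (volume : Measure unitInterval)))

instance (d : ℕ) (β : ℝ) (hβ : 0 < β) : IsProbabilityMeasure (configMeasure d β hβ) := by
  have := isProbabilityMeasure_weightLaw hβ
  unfold configMeasure
  infer_instance

variable {d : ℕ}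

/-- The vertices `i` and `j` are joined as far as their pair variable is concerned. -/
def Linked (η α r : ℝ) (ω : Config d) (i j : ℕ) : Prop :=
  (ω.2.2 s(i, j) : ℝ) ≤ connectionProb η α r (ω.1 i) (ω.2.1 i) (ω.1 j) (ω.2.1 j)

lemma Linked.symm {η α r : ℝ} {ω : Config d} {i j : ℕ} (h : Linked η α r ω i j) :
    Linked η α r ω j i := by
  unfold Linked at *
  rwa [Sym2.eq_swap, connectionProb_comm]

open Classical in
/-- The vertices of `S` within distance `r` of the vertex `i` and joined to it. -/
def nbrs (η α r : ℝ) (S : Finset ℕ) (ω : Config d) (i : ℕ) : Finset ℕ :=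
  S.filter fun k => toroidalDist (ω.1 i) (ω.1 k) < r ∧ Linked η α r ω i k

lemma measurable_connectionProb (η α r : ℝ) {Ω : Type*} [MeasurableSpace Ω]
    {x y : Ω → EuclideanSpace ℝ (Fin d)} {w v : Ω → ℝ} (hx : Measurable x) (hw : Measurable w)
    (hy : Measurable y) (hv : Measurable v) :
    Measurable fun ω => connectionProb η α r (x ω) (w ω) (y ω) (v ω) := by
  have h1 : Measurable fun ω => toroidalDist (x ω) (y ω) :=
    measurable_toroidalDist.comp (f := fun ω => (x ω, y ω)) (hx.prodMk hy)
  unfold connectionProb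
  fun_prop

lemma measurableSet_linked (η α r : ℝ) (i j : ℕ) :
    MeasurableSet {ω : Config d | Linked η α r ω i j} := by
  refine measurableSet_le (f := fun ω : Config d => (ω.2.2 s(i, j) : ℝ)) (by fun_prop) ?_
  exact measurable_connectionProb η α r (by fun_prop) (by fun_prop) (by fun_prop) (by fun_prop)

lemma measurable_toroidalDist_points (i j : ℕ) :
    Measurable fun ω : Config d => toroidalDist (ω.1 i) (ω.1 j) :=
  measurable_toroidalDist.comp (f := fun ω : Config d => (ω.1 i, ω.1 j)) (by fun_prop)

lemma connectionProb_le_one {η α r : ℝ} (x y : EuclideanSpace ℝ (Fin d)) {w v : ℝ} :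
    connectionProb η α r x w y v ≤ 1 := by
  unfold connectionProb
  linarith [Real.exp_pos (-(η * w * v / (toroidalDist x y / r) ^ α))]

/-- Vertices at distance at most `D r` are joined with probability bounded below. -/
lemma le_connectionProb {η α r D : ℝ} (hη : 0 < η) (hα : 0 < α) (hr : 0 < r)
    {x y : EuclideanSpace ℝ (Fin d)} {w v : ℝ} (hw : 1 ≤ w) (hv : 1 ≤ v)
    (h0 : 0 < toroidalDist x y) (hxy : toroidalDist x y ≤ D * r) :
    1 - Real.exp (-(η / D ^ α)) ≤ connectionProb η α r x w y v := by
  unfold connectionProb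
  have h1 : (toroidalDist x y / r) ^ α ≤ D ^ α := by
    refine Real.rpow_le_rpow (by positivity) ?_ hα.le
    rw [div_le_iff₀ hr]; exact hxy
  have h2 : 0 < (toroidalDist x y / r) ^ α := by positivity
  have h3 : η ≤ η * w * v := by nlinarith [mul_le_mul hw hv zero_le_one (by linarith)]
  have h4 : η / D ^ α ≤ η * w * v / (toroidalDist x y / r) ^ α := by gcongr
  have := Real.exp_le_exp.2 (neg_le_neg h4)
  linarith

lemma weightLaw_ae_one_le {β : ℝ} (hβ : 0 < β) : ∀ᵐ w ∂(weightLaw β), 1 ≤ w := by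
  have := isProbabilityMeasure_weightLaw hβ
  have h : Ioi (1 : ℝ) ∈ ae (weightLaw β) := by
    rw [mem_ae_iff_prob_eq_one measurableSet_Ioi, weightLaw_Ioi hβ le_rfl]
    simp
  filter_upwards [h] with w hw using le_of_lt hw

lemma ae_weights {β : ℝ} (hβ : 0 < β) : ∀ᵐ ω ∂(configMeasure d β hβ), ∀ i, 1 ≤ ω.2.1 i := by
  have := isProbabilityMeasure_weightLaw hβ
  refine ae_all_iff.2 fun i => ?_
  have hmp : MeasurePreserving (fun ω : Config d => ω.2.1 i) (configMeasure d β hβ)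
      (weightLaw β) :=
    (measurePreserving_eval_infinitePi (fun _ : ℕ => weightLaw β) i).comp
      (measurePreserving_fst.comp measurePreserving_snd)
  exact hmp.quasiMeasurePreserving.ae (weightLaw_ae_one_le hβ)

lemma ae_points {β : ℝ} (hβ : 0 < β) : ∀ᵐ ω ∂(configMeasure d β hβ), ∀ i, ω.1 i ∈ unitCube d := by
  have := isProbabilityMeasure_weightLaw hβ
  refine ae_all_iff.2 fun i => ?_
  have hmp : MeasurePreserving (fun ω : Config d => ω.1 i) (configMeasure d β hβ)
      (uniformCube d) :=
    (measurePreserving_eval_infinitePi (fun _ : ℕ => uniformCube d) i).comp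
      measurePreserving_fst
  exact hmp.quasiMeasurePreserving.ae (ae_restrict_mem (measurableSet_unitCube d))

/-- Coincident points have to be excluded because division by zero gives them connection probability
zero, which defeats `le_connectionProb`. They form a null set by Fubini, a countable set being null.
-/
lemma ae_toroidalDist_pos {β : ℝ} (hd : 0 < d) (hβ : 0 < β) :
    ∀ᵐ ω ∂(configMeasure d β hβ), ∀ i j, i ≠ j → 0 < toroidalDist (ω.1 i) (ω.1 j) := by
  have := isProbabilityMeasure_weightLaw hβ
  refine ae_all_iff.2 fun i => ae_all_iff.2 fun j => ?_
  by_cases hij : i = j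
  · simp [hij]
  set μ := Measure.infinitePi fun _ : ℕ => uniformCube d
  have h1 : ∀ᵐ x ∂μ, 0 < toroidalDist (x i) (x j) := by
    set N : Set (EuclideanSpace ℝ (Fin d) × EuclideanSpace ℝ (Fin d)) :=
      {p | toroidalDist p.1 p.2 = 0}
    have h0 : MeasurableSet N := measurable_toroidalDist (measurableSet_singleton 0)
    have h := lintegral_pivot_prod_infinitePi (fun _ : ℕ => uniformCube d) i {j}
      (by simpa using hij) (fun _ => 1) measurable_const
      (fun _ x y => N.indicator (fun _ => 1) (x, y)) (fun _ => measurable_const.indicator h0)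
    have h2 : ∀ x, ∫⁻ y, N.indicator (fun _ => 1) (x, y) ∂(uniformCube d) = 0 := by
      intro x
      change ∫⁻ y, ((fun y => (x, y)) ⁻¹' N).indicator 1 y ∂(uniformCube d) = 0
      rw [lintegral_indicator_one (h0.preimage measurable_prodMk_left)]
      exact uniformCube_toroidalDist_eq_zero hd x
    simp only [Finset.prod_singleton, h2, mul_zero, lintegral_zero, one_mul] at h
    have hm' : Measurable fun x : ℕ → EuclideanSpace ℝ (Fin d) =>
        N.indicator (fun _ => (1 : ℝ≥0∞)) (x i, x j) := (measurable_const.indicator h0).comp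
      (g := N.indicator (fun _ => (1 : ℝ≥0∞)))
      (f := fun x : ℕ → EuclideanSpace ℝ (Fin d) => (x i, x j)) (by fun_prop)
    rw [lintegral_eq_zero_iff hm'] at h
    filter_upwards [h] with x hx
    refine lt_of_le_of_ne (toroidalDist_nonneg _ _) fun h' => ?_
    have hmem : (x i, x j) ∈ N := h'.symm
    simp [hmem] at hx
  have hmp : MeasurePreserving (fun ω : Config d => ω.1) (configMeasure d β hβ) μ :=
    measurePreserving_fst
  filter_upwards [hmp.quasiMeasurePreserving.ae h1] with ω hω _ using hω

/-- The vertices `i` and `j` are at distance at most `D r` and have at least `m` neighbours each, but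
the two neighbourhoods are disjoint and no edge joins them. -/
def separatedEvent (η α r D : ℝ) (m : ℕ) (S : Finset ℕ) (i j : ℕ) : Set (Config d) :=
  {ω | (m ≤ (nbrs η α r S ω i).card ∧ m ≤ (nbrs η α r S ω j).card ∧
      Disjoint (nbrs η α r S ω i) (nbrs η α r S ω j) ∧
      ∀ k ∈ nbrs η α r S ω i, ∀ l ∈ nbrs η α r S ω j, ¬ Linked η α r ω k l) ∧
      toroidalDist (ω.1 i) (ω.1 j) ≤ D * r ∧ (∀ k, 1 ≤ ω.2.1 k) ∧
      ∀ k l, k ≠ l → 0 < toroidalDist (ω.1 k) (ω.1 l)}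

lemma measurableSet_separatedEvent (η α r D : ℝ) (m : ℕ) (S : Finset ℕ) (i j : ℕ) :
    MeasurableSet (separatedEvent (d := d) η α r D m S i j) := by
  classical
  have hnb : ∀ i k, MeasurableSet {ω : Config d |
      toroidalDist (ω.1 i) (ω.1 k) < r ∧ Linked η α r ω i k} := fun i k =>
    (measurableSet_lt (measurable_toroidalDist_points i k) measurable_const).inter
      (measurableSet_linked η α r i k)
  refine (measurableSet_separated m S S _ _ _ (hnb i) (hnb j)
    (fun k l => (measurableSet_linked η α r k l).compl)).inter
    ((measurableSet_le (measurable_toroidalDist_points i j) measurable_const).inter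
      (MeasurableSet.inter (s₁ := {ω : Config d | ∀ k, 1 ≤ ω.2.1 k})
        (s₂ := {ω : Config d | ∀ k l, k ≠ l → 0 < toroidalDist (ω.1 k) (ω.1 l)}) ?_ ?_))
  · have : {ω : Config d | ∀ k, 1 ≤ ω.2.1 k} = ⋂ k, {ω | 1 ≤ ω.2.1 k} := by ext; simp
    rw [this]
    exact MeasurableSet.iInter fun k => measurableSet_le measurable_const (by fun_prop)
  · have : {ω : Config d | ∀ k l, k ≠ l → 0 < toroidalDist (ω.1 k) (ω.1 l)} =
        ⋂ k, ⋂ l, ⋂ _ : k ≠ l, {ω | 0 < toroidalDist (ω.1 k) (ω.1 l)} := by ext; simp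
    rw [this]
    exact MeasurableSet.iInter fun k => MeasurableSet.iInter fun l => MeasurableSet.iInter fun _ =>
      measurableSet_lt measurable_const (measurable_toroidalDist_points k l)

/-- Two vertices with many neighbours are joined by a path, except with small probability. -/
lemma measure_separatedEvent_le {η α r β D : ℝ} (hη : 0 < η) (hα : 0 < α) (hr : 0 < r)
    (hβ : 0 < β) (hD : 0 ≤ D) (m i j : ℕ) (S : Finset ℕ) (hi : i ∉ S) (hj : j ∉ S) :
    configMeasure d β hβ (separatedEvent η α r D m S i j) ≤
    ENNReal.ofReal (Real.exp (-(η / (D + 2) ^ α))) ^ (m * m) := by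
  classical
  have := isProbabilityMeasure_weightLaw hβ
  set p := 1 - Real.exp (-(η / (D + 2) ^ α)) with hp
  have hexp : Real.exp (-(η / (D + 2) ^ α)) ≤ 1 := by
    rw [Real.exp_le_one_iff, neg_nonpos]; positivity
  have hp0 : 0 ≤ p := by linarith
  have hp1 : Real.exp (-(η / (D + 2) ^ α)) = 1 - p := by rw [hp]; ring
  rw [hp1]
  have hS := measurableSet_separatedEvent (d := d) η α r D m S i j
  rw [configMeasure, Measure.prod_apply hS]
  refine (lintegral_mono (g := fun _ => ENNReal.ofReal (1 - p) ^ (m * m)) fun X => ?_).trans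
    (by simp)
  rw [Measure.prod_apply (measurable_prodMk_left hS)]
  refine (lintegral_mono (g := fun _ => ENNReal.ofReal (1 - p) ^ (m * m)) fun W => ?_).trans
    (by simp)
  -- Locations and weights are now frozen; if they violate the deterministic conditions of the
  -- event, the section is empty.
  by_cases hgood : toroidalDist (X i) (X j) ≤ D * r ∧ (∀ k, 1 ≤ W k) ∧
      ∀ k l, k ≠ l → 0 < toroidalDist (X k) (X l)
  swap
  · refine le_of_eq_of_le ?_ zero_le
    convert measure_empty
    · ext u
      simp only [mem_preimage, mem_empty_iff_false, iff_false]
      exact fun h => hgood h.2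
    · infer_instance
  obtain ⟨hX, hW, hpos⟩ := hgood
  set c : Sym2 ℕ → ℝ := Sym2.lift ⟨fun k l => connectionProb η α r (X k) (W k) (X l) (W l),
    fun k l => connectionProb_comm _ _ _ _ _ _ _⟩ with hc
  set R := S.filter fun k => toroidalDist (X i) (X k) < r
  set R' := S.filter fun k => toroidalDist (X j) (X k) < r
  refine le_trans (measure_mono ?_) (percolation_separated_le m i j c p R R'
    (fun h => hi (Finset.mem_filter.1 h).1) (fun h => hj (Finset.mem_filter.1 h).1)
    (fun h => hi (Finset.mem_filter.1 h).1) (fun h => hj (Finset.mem_filter.1 h).1) ?_ hp0)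
  · intro u hu
    -- Filtering by distance first leaves candidate sets that depend on the locations alone, so that
    -- only bond percolation remains.
    have hn : ∀ i, nbrs η α r S (X, W, u) i =
        (S.filter fun k => toroidalDist (X i) (X k) < r).filter
          fun k => (u s(i, k) : ℝ) ≤ c s(i, k) := by
      intro i
      rw [Finset.filter_filter]
      unfold nbrs Linked
      congr!
    have h := hu.1
    simp only [hn, Linked, not_le] at h
    exact h
  · intro k hk l hl hkl
    have h1 := (Finset.mem_filter.1 hk).2
    have h2 := (Finset.mem_filter.1 hl).2
    refine le_connectionProb hη hα hr (hW k) (hW l) (hpos k l hkl) ?_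
    -- The route from `k` through `i` and `j` to `l` has length at most `r + D r + r`, whence the
    -- constant `D + 2`.
    have h3 := toroidalDist_triangle (X k) (X i) (X l)
    have h4 := toroidalDist_triangle (X i) (X j) (X l)
    rw [toroidalDist_comm (X k) (X i)] at h3
    change toroidalDist (X k) (X l) ≤ _
    linarith

end Config

/-! ### Lower tail of the number of short-range neighbours of a vertex. -/

section Degree

variable {d : ℕ}

/-- No integrability is needed in this direction, because the Bochner integral of a non-integrable
function is zero. -/
lemma ofReal_integral_le_lintegral {Ω : Type*} [MeasurableSpace Ω] {μ : Measure Ω} {f : Ω → ℝ}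
    (hf : 0 ≤ᵐ[μ] f) : ENNReal.ofReal (∫ x, f x ∂μ) ≤ ∫⁻ x, ENNReal.ofReal (f x) ∂μ := by
  by_cases h : Integrable f μ
  · exact (ofReal_integral_eq_lintegral_ofReal h hf).le
  · simp [integral_undef h]

lemma one_sub_exp_nonneg {η α w t : ℝ} (hη : 0 ≤ η) (hw : 0 ≤ w) (ht : 0 ≤ t) :
    0 ≤ 1 - Real.exp (-(η * w / t ^ α)) := by
  rw [sub_nonneg, Real.exp_le_one_iff, neg_nonpos]
  positivity

lemma ofReal_kappa_le {η α β : ℝ} (hη : 0 ≤ η) (hβ : 0 < β) :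
    ENNReal.ofReal (kappa d η α β) ≤ ∫⁻ z in Metric.ball (0 : EuclideanSpace ℝ (Fin d)) 1,
      ∫⁻ w, ENNReal.ofReal (1 - Real.exp (-(η * w / ‖z‖ ^ α))) ∂(weightLaw β) := by
  have hnn : ∀ z : EuclideanSpace ℝ (Fin d),
      0 ≤ᵐ[weightLaw β] fun w => 1 - Real.exp (-(η * w / ‖z‖ ^ α)) := by
    intro z
    filter_upwards [weightLaw_ae_one_le hβ] with w hw
    exact one_sub_exp_nonneg hη (by linarith) (norm_nonneg z)
  refine (ofReal_integral_le_lintegral (ae_of_all _ fun z =>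
    integral_nonneg_of_ae (hnn z))).trans (lintegral_mono fun z => ?_)
  exact ofReal_integral_le_lintegral (hnn z)

/-- On the punctured unit ball `η w / ‖z‖ ^ α` is at least `η`, so the integrand is at least `1 -
exp (-η)`. -/
lemma kappa_pos {η α β : ℝ} (hη : 0 < η) (hα : 0 < α) (hβ : 0 < β) (hd : 0 < d) :
    0 < kappa d η α β := by
  have := isProbabilityMeasure_weightLaw hβ
  have : Nonempty (Fin d) := ⟨⟨0, hd⟩⟩
  have hmeas : Measurable fun p : EuclideanSpace ℝ (Fin d) × ℝ =>
      1 - Real.exp (-(η * p.2 / ‖p.1‖ ^ α)) := by fun_prop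
  have hbd : ∀ z : EuclideanSpace ℝ (Fin d), ∀ᵐ w ∂(weightLaw β),
      ‖1 - Real.exp (-(η * w / ‖z‖ ^ α))‖ ≤ 1 := by
    intro z
    filter_upwards [weightLaw_ae_one_le hβ] with w hw
    have h1 := one_sub_exp_nonneg (α := α) hη.le (by linarith : 0 ≤ w) (norm_nonneg z)
    rw [Real.norm_of_nonneg h1]
    linarith [Real.exp_pos (-(η * w / ‖z‖ ^ α))]
  have hint : ∀ z : EuclideanSpace ℝ (Fin d),
      Integrable (fun w => 1 - Real.exp (-(η * w / ‖z‖ ^ α))) (weightLaw β) := fun z =>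
    Integrable.of_bound (hmeas.comp measurable_prodMk_left).aestronglyMeasurable 1 (hbd z)
  have hfin : volume (Metric.ball (0 : EuclideanSpace ℝ (Fin d)) 1) ≠ ∞ :=
    measure_ball_lt_top.ne
  have hvol : 0 < volume.real (Metric.ball (0 : EuclideanSpace ℝ (Fin d)) 1) :=
    ENNReal.toReal_pos (Metric.measure_ball_pos volume _ one_pos).ne' hfin
  have hint2 : IntegrableOn (fun z : EuclideanSpace ℝ (Fin d) =>
      ∫ w, (1 - Real.exp (-(η * w / ‖z‖ ^ α))) ∂(weightLaw β)) (Metric.ball 0 1) := by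
    refine Measure.integrableOn_of_bounded (M := 1) hfin ?_ (ae_of_all _ fun z => ?_)
    · exact (hmeas.stronglyMeasurable.integral_prod_right (ν := weightLaw β)).aestronglyMeasurable
    · simpa using norm_integral_le_of_norm_le_const (hbd z)
  have hη1 : 0 < 1 - Real.exp (-η) := by
    rw [sub_pos, Real.exp_lt_one_iff]; linarith
  have hnull : ∀ᵐ z : EuclideanSpace ℝ (Fin d), z ≠ 0 := by
    rw [ae_iff]; simp
  calc (0 : ℝ) < (1 - Real.exp (-η)) * volume.real (Metric.ball (0 : EuclideanSpace ℝ (Fin d)) 1) :=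
        mul_pos hη1 hvol
    _ = ∫ z in Metric.ball (0 : EuclideanSpace ℝ (Fin d)) 1, (1 - Real.exp (-η)) := by
        rw [setIntegral_const, smul_eq_mul, mul_comm]
    _ ≤ kappa d η α β := by
        refine setIntegral_mono_on_ae (integrableOn_const hfin) hint2
          Metric.isOpen_ball.measurableSet ?_
        filter_upwards [hnull] with z hz hzb
        have h0 : 0 < ‖z‖ := norm_pos_iff.2 hz
        have h1 : ‖z‖ < 1 := by simpa using hzb
        calc 1 - Real.exp (-η) = ∫ _w, (1 - Real.exp (-η)) ∂(weightLaw β) := by simp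
          _ ≤ _ := by
            refine integral_mono_ae (integrable_const _) (hint z) ?_
            filter_upwards [weightLaw_ae_one_le hβ] with w hw
            have h2 : ‖z‖ ^ α ≤ 1 := Real.rpow_le_one h0.le h1.le hα.le
            have h3 : 0 < ‖z‖ ^ α := by positivity
            have h4 : η ≤ η * w / ‖z‖ ^ α := by
              rw [le_div_iff₀ h3]; nlinarith
            have := Real.exp_le_exp.2 (neg_le_neg h4)
            linarith

/-- For negative `c` the left side is zero; otherwise `c ≤ 1` keeps `[0, c]` inside the unit
interval. -/
lemma ofReal_le_volume_unitInterval {c : ℝ} (hc : c ≤ 1) :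
    ENNReal.ofReal c ≤ volume {u : unitInterval | (u : ℝ) ≤ c} := by
  have hms : MeasurableSet {u : unitInterval | (u : ℝ) ≤ c} :=
    measurableSet_le measurable_subtype_coe measurable_const
  rw [unitInterval.volume_def, Measure.comap_apply _ Subtype.val_injective
    (fun s hs => measurableSet_Icc.subtype_image hs) _ hms]
  calc ENNReal.ofReal c = volume (Icc 0 c) := by simp
    _ ≤ volume (Subtype.val '' {u : unitInterval | (u : ℝ) ≤ c}) := measure_mono fun x hx =>
        ⟨⟨x, hx.1, hx.2.trans hc⟩, hx.2, rfl⟩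

lemma measurableSet_near_linked (η α r : ℝ) {Ω : Type*} [MeasurableSpace Ω]
    {x y : Ω → EuclideanSpace ℝ (Fin d)} {w v u : Ω → ℝ} (hx : Measurable x) (hw : Measurable w)
    (hy : Measurable y) (hv : Measurable v) (hu : Measurable u) :
    MeasurableSet {ω | toroidalDist (x ω) (y ω) < r ∧
      u ω ≤ connectionProb η α r (x ω) (w ω) (y ω) (v ω)} := by
  refine MeasurableSet.inter (s₁ := {ω | toroidalDist (x ω) (y ω) < r})
    (measurableSet_lt ?_ measurable_const) (measurableSet_le hu (measurable_connectionProb η α r hx hw hy hv))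
  exact measurable_toroidalDist.comp (f := fun ω => (x ω, y ω)) (hx.prodMk hy)

/-- The probability that a given vertex of weight at least one is joined to a random vertex within
distance `r` is at least `κ r ^ d`. -/
lemma ofReal_le_lintegral_near_linked {η α β r : ℝ} (hη : 0 < η) (hβ : 0 < β)
    (hr0 : 0 < r) (hr : r ≤ 1 / 2) (x : EuclideanSpace ℝ (Fin d)) {a : ℝ} (ha : 1 ≤ a) :
    ENNReal.ofReal (kappa d η α β * r ^ d) ≤
      ∫⁻ y, ∫⁻ b, ∫⁻ u : unitInterval,
        {q : EuclideanSpace ℝ (Fin d) × ℝ × unitInterval | toroidalDist x q.1 < r ∧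
          (q.2.2 : ℝ) ≤ connectionProb η α r x a q.1 q.2.1}.indicator (fun _ => 1) (y, b, u)
        ∂volume ∂(weightLaw β) ∂(uniformCube d) := by
  set h : ℝ → ℝ≥0∞ := fun t =>
    ∫⁻ b, ENNReal.ofReal (1 - Real.exp (-(η * b / (t / r) ^ α))) ∂(weightLaw β)
  calc ENNReal.ofReal (kappa d η α β * r ^ d)
      = ENNReal.ofReal (r ^ d) * ENNReal.ofReal (kappa d η α β) := by
        rw [mul_comm, ENNReal.ofReal_mul (by positivity)]
    _ ≤ ENNReal.ofReal (r ^ d) *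
          ∫⁻ z in Metric.ball (0 : EuclideanSpace ℝ (Fin d)) 1, h (r * ‖z‖) := by
        refine mul_le_mul_right ((ofReal_kappa_le hη.le hβ).trans_eq ?_) _
        simp only [h, mul_div_cancel_left₀ _ hr0.ne']
    _ ≤ ∫⁻ y, (if toroidalDist x y < r then h (toroidalDist x y) else 0) ∂(uniformCube d) :=
        lintegral_ball_le_lintegral_toroidalDist x h hr0 hr
    _ ≤ _ := by
        refine lintegral_mono fun y => ?_
        dsimp only
        split_ifs with hy
        swap
        · exact zero_le
        refine lintegral_mono_ae ?_
        filter_upwards [weightLaw_ae_one_le hβ] with b hb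
        -- Lowering the weight `a ≥ 1` to one turns the connection probability into the integrand of
        -- `kappa`, which involves a single weight.
        have h1 : 1 - Real.exp (-(η * b / (toroidalDist x y / r) ^ α)) ≤
            connectionProb η α r x a y b := by
          have h0 := toroidalDist_nonneg x y
          have h2 : η * b / (toroidalDist x y / r) ^ α ≤
              η * a * b / (toroidalDist x y / r) ^ α := by
            refine div_le_div_of_nonneg_right ?_ (by positivity)
            nlinarith [mul_nonneg (mul_nonneg hη.le (sub_nonneg.2 ha)) (zero_le_one.trans hb)]
          have := Real.exp_le_exp.2 (neg_le_neg h2)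
          unfold connectionProb
          linarith
        refine ((ENNReal.ofReal_le_ofReal h1).trans
          (ofReal_le_volume_unitInterval (connectionProb_le_one x y))).trans_eq ?_
        rw [← lintegral_indicator_one (measurableSet_le measurable_subtype_coe measurable_const)]
        refine lintegral_congr fun u => ?_
        simp [indicator_apply, hy]

/-- A vertex with weight at least one has few neighbours within distance `r` with small
probability. -/
lemma measure_few_nbrs_le {η α β r θ : ℝ} (hd : 0 < d) (hη : 0 < η) (hα : 0 < α) (hβ : 0 < β)
    (hr0 : 0 < r) (hr : r ≤ 1 / 2) (hθ0 : 0 < θ) (hθ1 : θ < 1) (m i : ℕ) (S : Finset ℕ)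
    (hi : i ∉ S) :
    ENNReal.ofReal θ ^ m * configMeasure d β hβ
      {ω | 1 ≤ ω.2.1 i ∧ (nbrs η α r S ω i).card ≤ m} ≤
    ENNReal.ofReal (1 - (1 - θ) * (kappa d η α β * r ^ d)) ^ S.card := by
  classical
  have := isProbabilityMeasure_weightLaw hβ
  set N : Set (EuclideanSpace ℝ (Fin d) × ℝ × EuclideanSpace ℝ (Fin d) × ℝ × unitInterval) :=
    {q | toroidalDist q.1 q.2.2.1 < r ∧
      (q.2.2.2.2 : ℝ) ≤ connectionProb η α r q.1 q.2.1 q.2.2.1 q.2.2.2.1} with hN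
  have hNm : MeasurableSet N := measurableSet_near_linked η α r (by fun_prop) (by fun_prop)
    (by fun_prop) (by fun_prop) (by fun_prop)
  -- A factor `θ` for each neighbour makes the product over `S` equal to `θ` to the number of
  -- neighbours, ready for Markov's inequality.
  set g : EuclideanSpace ℝ (Fin d) × ℝ × EuclideanSpace ℝ (Fin d) × ℝ × unitInterval → ℝ≥0∞ :=
    fun q => if q ∈ N then ENNReal.ofReal θ else 1 with hg
  have hgm : Measurable g := Measurable.ite hNm measurable_const measurable_const
  set φ : ℝ → ℝ≥0∞ := (Ici 1).indicator fun _ => 1 with hφ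
  have hφm : Measurable φ := measurable_const.indicator measurableSet_Ici
  set F : Config d → ℝ≥0∞ := fun ω => φ (ω.2.1 i) *
    ∏ j ∈ S, g (ω.1 i, ω.2.1 i, ω.1 j, ω.2.1 j, ω.2.2 s(i, j)) with hF
  have hFm : Measurable F := by
    refine (hφm.comp (by fun_prop)).mul (Finset.measurable_prod S fun j _ => ?_)
    exact hgm.comp (f := fun ω : Config d =>
      (ω.1 i, ω.2.1 i, ω.1 j, ω.2.1 j, ω.2.2 s(i, j))) (by fun_prop)
  have hFprod : ∀ ω : Config d, ∏ j ∈ S, g (ω.1 i, ω.2.1 i, ω.1 j, ω.2.1 j, ω.2.2 s(i, j)) =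
      ENNReal.ofReal θ ^ (nbrs η α r S ω i).card := by
    intro ω
    rw [nbrs, ← Finset.prod_const, Finset.prod_filter]
    rfl
  have hθ' : ENNReal.ofReal θ ≤ 1 := by rw [ENNReal.ofReal_le_one]; exact hθ1.le
  have hMarkov : ENNReal.ofReal θ ^ m * configMeasure d β hβ
      {ω | 1 ≤ ω.2.1 i ∧ (nbrs η α r S ω i).card ≤ m} ≤ ∫⁻ ω, F ω ∂(configMeasure d β hβ) := by
    refine (mul_le_mul_right (measure_mono fun ω hω => ?_) _).trans
      (mul_meas_ge_le_lintegral hFm (ENNReal.ofReal θ ^ m))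
    change _ ≤ φ (ω.2.1 i) * _
    rw [hFprod, hφ, indicator_of_mem (show ω.2.1 i ∈ Ici 1 from hω.1), one_mul]
    exact pow_le_pow_right_of_le_one' hθ' hω.2
  refine hMarkov.trans ?_
  set κ := kappa d η α β * r ^ d
  have hκ : 0 ≤ κ := mul_nonneg (kappa_pos hη hα hβ hd).le (by positivity)
  have hone : ∀ (x : EuclideanSpace ℝ (Fin d)) (a : ℝ), 1 ≤ a →
      ∫⁻ y, ∫⁻ b, ∫⁻ u, g (x, a, y, b, u) ∂volume ∂(weightLaw β) ∂(uniformCube d) ≤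
        ENNReal.ofReal (1 - (1 - θ) * κ) := by
    intro x a ha
    set M : Set (EuclideanSpace ℝ (Fin d) × ℝ × unitInterval) := {q | toroidalDist x q.1 < r ∧
          (q.2.2 : ℝ) ≤ connectionProb η α r x a q.1 q.2.1}
    have hMm : MeasurableSet M := measurableSet_near_linked η α r (by fun_prop) (by fun_prop)
      (by fun_prop) (by fun_prop) (by fun_prop)
    have h1 := ofReal_le_lintegral_near_linked (α := α) hη hβ hr0 hr x ha
    set J : EuclideanSpace ℝ (Fin d) × ℝ × unitInterval → ℝ≥0∞ := M.indicator fun _ => 1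
    have hJm : Measurable J := measurable_const.indicator hMm
    -- This is `g = 1 - (1 - θ) J`, stated additively to avoid truncated subtraction.
    have hsum : ∀ q, g (x, a, q) + ENNReal.ofReal (1 - θ) * J q = 1 := by
      intro q
      by_cases hq : q ∈ M
      · have : (x, a, q) ∈ N := hq
        simp only [hg, J, this, hq, if_true, indicator_of_mem, mul_one]
        rw [← ENNReal.ofReal_add hθ0.le (by linarith)]
        simp
      · have : (x, a, q) ∉ N := hq
        simp only [hg, J, this, hq, if_false, not_false_eq_true, indicator_of_notMem, mul_zero,
          add_zero]
    set P := (uniformCube d).prod ((weightLaw β).prod (volume : Measure unitInterval))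
    have hgm' : Measurable fun q => g (x, a, q) := hgm.comp (by fun_prop)
    have hit : ∀ f : EuclideanSpace ℝ (Fin d) × ℝ × unitInterval → ℝ≥0∞, Measurable f →
        ∫⁻ q, f q ∂P = ∫⁻ y, ∫⁻ b, ∫⁻ u, f (y, b, u) ∂volume ∂(weightLaw β) ∂(uniformCube d) := by
      intro f hf
      rw [lintegral_prod _ hf.aemeasurable]
      refine lintegral_congr fun y => ?_
      exact lintegral_prod _ (hf.comp measurable_prodMk_left).aemeasurable
    have h2 : ∫⁻ q, g (x, a, q) ∂P + ENNReal.ofReal (1 - θ) * ∫⁻ q, J q ∂P = 1 := by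
      rw [← lintegral_const_mul _ hJm, ← lintegral_add_left hgm']
      simp [hsum, P]
    rw [← hit J hJm] at h1
    rw [← hit _ hgm']
    have h3 : ENNReal.ofReal ((1 - θ) * κ) ≤ ENNReal.ofReal (1 - θ) * ∫⁻ q, J q ∂P := by
      rw [ENNReal.ofReal_mul (by linarith)]
      exact mul_le_mul_right h1 _
    rw [ENNReal.ofReal_sub _ (mul_nonneg (by linarith) hκ), ENNReal.ofReal_one]
    refine ENNReal.le_sub_of_add_le_right ENNReal.ofReal_ne_top ?_
    rw [← h2]
    exact add_le_add_right h3 _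
  have hinj : Function.Injective fun j => s(i, j) := fun j k h => Sym2.congr_right.1 h
  -- Pair variables are integrated out first, then weights, then locations. Given the location and
  -- weight of `i`, the other vertices contribute independent factors.
  set g₁ : EuclideanSpace ℝ (Fin d) × ℝ × EuclideanSpace ℝ (Fin d) × ℝ → ℝ≥0∞ :=
    fun q => ∫⁻ u, g (q.1, q.2.1, q.2.2.1, q.2.2.2, u) ∂volume
  have hg₁m : Measurable g₁ := Measurable.lintegral_prod_right'
    (f := fun p : (EuclideanSpace ℝ (Fin d) × ℝ × EuclideanSpace ℝ (Fin d) × ℝ) × unitInterval =>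
      g (p.1.1, p.1.2.1, p.1.2.2.1, p.1.2.2.2, p.2)) (hgm.comp (by fun_prop))
  set g₂ : EuclideanSpace ℝ (Fin d) × ℝ × EuclideanSpace ℝ (Fin d) → ℝ≥0∞ :=
    fun q => ∫⁻ b, g₁ (q.1, q.2.1, q.2.2, b) ∂(weightLaw β)
  have hg₂m : Measurable g₂ := Measurable.lintegral_prod_right'
    (f := fun p : (EuclideanSpace ℝ (Fin d) × ℝ × EuclideanSpace ℝ (Fin d)) × ℝ =>
      g₁ (p.1.1, p.1.2.1, p.1.2.2, p.2)) (hg₁m.comp (by fun_prop))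
  have hU : ∀ (X : ℕ → EuclideanSpace ℝ (Fin d)) (W : ℕ → ℝ),
      ∫⁻ U, F (X, W, U) ∂(Measure.infinitePi fun _ : Sym2 ℕ => (volume : Measure unitInterval)) =
        φ (W i) * ∏ j ∈ S, g₁ (X i, W i, X j, W j) := by
    intro X W
    have hgj : ∀ j, Measurable fun u => g (X i, W i, X j, W j, u) :=
      fun j => hgm.comp (by fun_prop)
    have h1 := lintegral_finset_prod_infinitePi
      (fun _ : Sym2 ℕ => (volume : Measure unitInterval)) (fun j => s(i, j)) hinj S
      (fun j u => g (X i, W i, X j, W j, u)) hgj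
    rw [← h1, ← lintegral_const_mul]
    exact Finset.measurable_prod S fun j _ => (hgj j).comp (measurable_pi_apply _)
  have hW : ∀ X : ℕ → EuclideanSpace ℝ (Fin d),
      ∫⁻ W, φ (W i) * ∏ j ∈ S, g₁ (X i, W i, X j, W j)
        ∂(Measure.infinitePi fun _ : ℕ => weightLaw β) =
        ∫⁻ a, φ a * ∏ j ∈ S, g₂ (X i, a, X j) ∂(weightLaw β) := fun X =>
    lintegral_pivot_prod_infinitePi (fun _ : ℕ => weightLaw β) i S hi φ hφm
      (fun j a b => g₁ (X i, a, X j, b)) fun j => hg₁m.comp (by fun_prop)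
  have hX : ∀ a, ∫⁻ X, φ a * ∏ j ∈ S, g₂ (X i, a, X j)
      ∂(Measure.infinitePi fun _ : ℕ => uniformCube d) =
        ∫⁻ x, φ a * ∏ _j ∈ S, ∫⁻ y, g₂ (x, a, y) ∂(uniformCube d) ∂(uniformCube d) := fun a =>
    lintegral_pivot_prod_infinitePi (fun _ : ℕ => uniformCube d) i S hi (fun _ => φ a)
      measurable_const (fun j x y => g₂ (x, a, y)) fun j => hg₂m.comp (by fun_prop)
  have hFm' : ∀ X, Measurable fun p : (ℕ → ℝ) × (Sym2 ℕ → unitInterval) => F (X, p) :=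
    fun X => hFm.comp measurable_prodMk_left
  rw [configMeasure, lintegral_prod _ hFm.aemeasurable]
  have hstep : ∀ X : ℕ → EuclideanSpace ℝ (Fin d), ∫⁻ p, F (X, p)
      ∂((Measure.infinitePi fun _ : ℕ => weightLaw β).prod
        (Measure.infinitePi fun _ : Sym2 ℕ => (volume : Measure unitInterval))) =
        ∫⁻ a, φ a * ∏ j ∈ S, g₂ (X i, a, X j) ∂(weightLaw β) := by
    intro X
    rw [lintegral_prod _ (hFm' X).aemeasurable]
    simp_rw [hU, hW]
  simp_rw [hstep]
  -- The weight of `i` moves outside, so that the locations are integrated with it held fixed.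
  rw [lintegral_lintegral_swap]
  swap
  · refine Measurable.aemeasurable (Measurable.mul (hφm.comp measurable_snd)
      (Finset.measurable_prod S fun j _ => ?_))
    exact hg₂m.comp (f := fun p : (ℕ → EuclideanSpace ℝ (Fin d)) × ℝ => (p.1 i, p.2, p.1 j))
      (by fun_prop)
  simp_rw [hX]
  calc _ ≤ ∫⁻ _a, ∫⁻ _x, ENNReal.ofReal (1 - (1 - θ) * κ) ^ S.card
        ∂(uniformCube d) ∂(weightLaw β) := by
        refine lintegral_mono fun a => lintegral_mono fun x => ?_
        by_cases ha : 1 ≤ a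
        · simp only [hφ, indicator_of_mem (show a ∈ Ici 1 from ha), one_mul, Finset.prod_const]
          exact pow_le_pow_left' (hone x a ha) _
        · simp only [hφ, indicator_of_notMem (show a ∉ Ici 1 from ha), zero_mul]
          exact zero_le
    _ = _ := by simp

end Degree

/-! ### The grid of cells and connectivity through occupied cells. -/

section Grid

variable {d : ℕ}

/-- The cells of the partition of the unit cube into `l ^ d` cubes of side `1 / l`. -/
def cell (l : ℕ) (c : Fin d → ℕ) : Set (EuclideanSpace ℝ (Fin d)) :=
  {x | ∀ i, x i ∈ Ioc (-(1 / 2) + (c i : ℝ) / l) (-(1 / 2) + ((c i : ℝ) + 1) / l)}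

lemma cell_subset_unitCube {l : ℕ} (hl : 0 < l) {c : Fin d → ℕ} (hc : ∀ i, c i < l) :
    cell l c ⊆ unitCube d := by
  intro x hx i
  have hl' : (0 : ℝ) < l := by exact_mod_cast hl
  have h1 : (0 : ℝ) ≤ (c i : ℝ) / l := by positivity
  have h2 : ((c i : ℝ) + 1) / l ≤ 1 := by
    rw [div_le_one hl']; exact_mod_cast hc i
  exact ⟨by linarith [(hx i).1], by linarith [(hx i).2]⟩

lemma volume_cell {l : ℕ} (c : Fin d → ℕ) :
    volume (cell l c) = ENNReal.ofReal (1 / l) ^ d := by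
  have h : cell l c = (MeasurableEquiv.toLp 2 (Fin d → ℝ)).symm ⁻¹'
      (Set.pi univ fun i => Ioc (-(1 / 2) + (c i : ℝ) / l) (-(1 / 2) + ((c i : ℝ) + 1) / l)) := by
    ext x
    simp [cell]
  rw [h, (EuclideanSpace.volume_preserving_symm_measurableEquiv_toLp (Fin d)).measure_preimage
    (MeasurableSet.univ_pi fun _ => measurableSet_Ioc).nullMeasurableSet, volume_pi_pi]
  have : ∀ i : Fin d, volume (Ioc (-(1 / 2) + (c i : ℝ) / l) (-(1 / 2) + ((c i : ℝ) + 1) / l)) =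
      ENNReal.ofReal (1 / l) := by
    intro i
    rw [Real.volume_Ioc]
    congr 1
    ring
  simp only [this, Finset.prod_const, Finset.card_univ, Fintype.card_fin]

lemma measurableSet_cell (l : ℕ) (c : Fin d → ℕ) : MeasurableSet (cell l c) := by
  have : cell l c = ⋂ i, {x : EuclideanSpace ℝ (Fin d) |
      x i ∈ Ioc (-(1 / 2) + (c i : ℝ) / l) (-(1 / 2) + ((c i : ℝ) + 1) / l)} := by
    ext x; simp [cell]
  rw [this]
  refine MeasurableSet.iInter fun i => ?_
  have hm : Measurable fun x : EuclideanSpace ℝ (Fin d) => x i := by fun_prop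
  exact hm measurableSet_Ioc

lemma exists_mem_cell {l : ℕ} (hl : 0 < l) {x : EuclideanSpace ℝ (Fin d)} (hx : x ∈ unitCube d) :
    ∃ c : Fin d → ℕ, (∀ i, c i < l) ∧ x ∈ cell l c := by
  have hl' : (0 : ℝ) < l := by exact_mod_cast hl
  have h : ∀ i, ∃ k : ℕ, k < l ∧
      x i ∈ Ioc (-(1 / 2) + (k : ℝ) / l) (-(1 / 2) + ((k : ℝ) + 1) / l) := by
    intro i
    have h1 := (hx i).1
    have h2 := (hx i).2
    have hpos : 0 < (x i + 1 / 2) * l := mul_pos (by linarith) hl'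
    have hc : 0 < ⌈(x i + 1 / 2) * l⌉₊ := Nat.ceil_pos.2 hpos
    -- Cells are open on the left and closed on the right, so the index is a ceiling minus one
    -- rather than a floor; the ceiling is positive, so the subtraction is not truncated.
    refine ⟨⌈(x i + 1 / 2) * l⌉₊ - 1, ?_, ?_, ?_⟩
    · have : ⌈(x i + 1 / 2) * l⌉₊ ≤ l := Nat.ceil_le.2 (by nlinarith)
      omega
    · have h3 := Nat.ceil_lt_add_one hpos.le
      rw [Nat.cast_sub hc, Nat.cast_one]
      have : ((⌈(x i + 1 / 2) * l⌉₊ : ℝ) - 1) / l < x i + 1 / 2 := by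
        rw [div_lt_iff₀ hl']; linarith
      linarith
    · have h3 := Nat.le_ceil ((x i + 1 / 2) * l)
      rw [Nat.cast_sub hc, Nat.cast_one, sub_add_cancel]
      have : x i + 1 / 2 ≤ (⌈(x i + 1 / 2) * l⌉₊ : ℝ) / l := by
        rw [le_div_iff₀ hl']; exact h3
      linarith
  choose c hc hxc using h
  exact ⟨c, hc, hxc⟩

/-- In the same or adjacent cells each coordinate differs by at most `2 / l`; the resulting factor
`√d` is bounded crudely by `d`. -/
lemma norm_sub_le_of_mem_cell {l : ℕ} {c c' : Fin d → ℕ} (h1 : ∀ i, c i ≤ c' i + 1)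
    (h2 : ∀ i, c' i ≤ c i + 1) {x y : EuclideanSpace ℝ (Fin d)} (hx : x ∈ cell l c)
    (hy : y ∈ cell l c') : ‖x - y‖ ≤ 2 * d / l := by
  have hb : ∀ i, |x i - y i| ≤ 2 / l := by
    intro i
    have e1 : (c i : ℝ) / l ≤ ((c' i : ℝ) + 1) / l := by
      gcongr; exact_mod_cast h1 i
    have e2 : (c' i : ℝ) / l ≤ ((c i : ℝ) + 1) / l := by
      gcongr; exact_mod_cast h2 i
    obtain ⟨x1, x2⟩ := hx i
    obtain ⟨y1, y2⟩ := hy i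
    have e3 : ∀ k : ℝ, (k + 1) / l = k / l + 1 / l := fun k => by ring
    have e4 : (2 : ℝ) / l = 1 / l + 1 / l := by ring
    rw [e3] at e1 e2 x2 y2
    rw [e4, abs_le]
    constructor <;> linarith
  rw [EuclideanSpace.norm_eq]
  refine Real.sqrt_le_iff.2 ⟨by positivity, ?_⟩
  calc ∑ i, ‖(x - y) i‖ ^ 2 ≤ ∑ _i : Fin d, (2 / (l : ℝ)) ^ 2 := by
        refine Finset.sum_le_sum fun i _ => ?_
        exact pow_le_pow_left₀ (norm_nonneg _) (hb i) 2
    _ = d * (2 / (l : ℝ)) ^ 2 := by simp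
    _ ≤ (d * d) * (2 / (l : ℝ)) ^ 2 := by
        refine mul_le_mul_of_nonneg_right ?_ (by positivity)
        exact_mod_cast Nat.le_mul_self d
    _ = (2 * d / l) ^ 2 := by ring

/-- A graph on points of the cube in which nearby points are connected is connected as soon as
every cell of a fine grid is occupied. -/
lemma connected_of_occupied_cells {n l : ℕ} (hl : 0 < l) (G : SimpleGraph (Fin n))
    (X : ℕ → EuclideanSpace ℝ (Fin d)) (hX : ∀ i, X i ∈ unitCube d)
    (hG : ∀ i j : Fin n, toroidalDist (X i) (X j) ≤ 2 * d / l → G.Reachable i j)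
    (hocc : ∀ c : Fin d → ℕ, (∀ i, c i < l) → ∃ k : Fin n, X k ∈ cell l c) : G.Connected := by
  have hnear : ∀ c c' : Fin d → ℕ, (∀ i, c i ≤ c' i + 1) → (∀ i, c' i ≤ c i + 1) →
      ∀ k k' : Fin n, X k ∈ cell l c → X k' ∈ cell l c' → G.Reachable k k' :=
    fun c c' h1 h2 k k' hk hk' => hG k k'
      ((toroidalDist_le_norm _ _).trans (norm_sub_le_of_mem_cell h1 h2 hk hk'))
  -- Induction on a bound `t` for the cell indices: truncating all of them at `t` moves to an
  -- adjacent or equal cell, again occupied, until both walks reach the corner cell.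
  have key : ∀ t : ℕ, ∀ c c' : Fin d → ℕ, (∀ i, c i < l) → (∀ i, c' i < l) → (∀ i, c i ≤ t) →
      (∀ i, c' i ≤ t) → ∀ k k' : Fin n, X k ∈ cell l c → X k' ∈ cell l c' →
        G.Reachable k k' := by
    intro t
    induction t with
    | zero =>
      intro c c' _ _ h h' k k' hk hk'
      exact hnear c c' (fun i => by have := h i; omega) (fun i => by have := h' i; omega)
        k k' hk hk'
    | succ t ih =>
      intro c c' hc hc' h h' k k' hk hk'
      have hm : ∀ i, min (c i) t < l := fun i => (min_le_left _ _).trans_lt (hc i)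
      have hm' : ∀ i, min (c' i) t < l := fun i => (min_le_left _ _).trans_lt (hc' i)
      obtain ⟨k₁, hk₁⟩ := hocc (fun i => min (c i) t) hm
      obtain ⟨k₁', hk₁'⟩ := hocc (fun i => min (c' i) t) hm'
      have e1 := hnear c _ (fun i => by have := h i; omega) (fun i => by omega) k k₁ hk hk₁
      have e2 := hnear c' _ (fun i => by have := h' i; omega) (fun i => by omega) k' k₁' hk' hk₁'
      have e3 := ih _ _ hm hm' (fun i => min_le_right _ _) (fun i => min_le_right _ _)
        k₁ k₁' hk₁ hk₁'
      exact e1.trans (e3.trans e2.symm)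
  obtain ⟨k₀, -⟩ := hocc (fun _ => 0) fun _ => hl
  refine (SimpleGraph.connected_iff _).2 ⟨fun k k' => ?_, ⟨k₀⟩⟩
  obtain ⟨c, hc, hk⟩ := exists_mem_cell hl (hX k)
  obtain ⟨c', hc', hk'⟩ := exists_mem_cell hl (hX k')
  exact key l c c' hc hc' (fun i => (hc i).le) (fun i => (hc' i).le) k k' hk hk'

/-- The `n` points are independent and uniform, and each misses a cell of volume `(1 / l) ^ d` with
the complementary probability. -/
lemma measure_cell_empty {β : ℝ} (hβ : 0 < β) (n : ℕ) {l : ℕ} (hl : 0 < l) {c : Fin d → ℕ}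
    (hc : ∀ i, c i < l) : configMeasure d β hβ {ω | ∀ k < n, ω.1 k ∉ cell l c} =
      ENNReal.ofReal (1 - (1 / (l : ℝ)) ^ d) ^ n := by
  have := isProbabilityMeasure_weightLaw hβ
  have hmp : MeasurePreserving (fun ω : Config d => ω.1) (configMeasure d β hβ)
      (Measure.infinitePi fun _ : ℕ => uniformCube d) := measurePreserving_fst
  have hset : {ω : Config d | ∀ k < n, ω.1 k ∉ cell l c} =
      (fun ω : Config d => ω.1) ⁻¹' (Set.pi (Finset.range n) fun _ => (cell l c)ᶜ) := by
    ext ω; simp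
  rw [hset, hmp.measure_preimage (MeasurableSet.pi (Finset.range n).countable_toSet
    fun _ _ => (measurableSet_cell l c).compl).nullMeasurableSet,
    Measure.infinitePi_pi _ fun _ _ => (measurableSet_cell l c).compl, Finset.prod_const,
    Finset.card_range, prob_compl_eq_one_sub (measurableSet_cell l c), uniformCube,
    Measure.restrict_apply (measurableSet_cell l c),
    inter_eq_left.2 (cell_subset_unitCube hl hc), volume_cell,
    ENNReal.ofReal_sub _ (by positivity), ENNReal.ofReal_one, ENNReal.ofReal_pow (by positivity)]

end Grid

/-! ### Union bound for a fixed number of vertices. -/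

section FixedSize

variable {d : ℕ}

lemma graph_adj_iff {η α r : ℝ} {n : ℕ} {ω : Config d} {i j : Fin n} :
    (graph η α r ((n, ω) : Sample d)).Adj i j ↔ i ≠ j ∧ Linked η α r ω i j := Iff.rfl

/-- Vertices with many neighbours that are not in the exceptional event are connected. -/
lemma reachable_of_notMem_separatedEvent {η α r D : ℝ} {n m : ℕ} {ω : Config d}
    (hW : ∀ k, 1 ≤ ω.2.1 k) (hpos : ∀ k l, k ≠ l → 0 < toroidalDist (ω.1 k) (ω.1 l))
    (hdeg : ∀ i < n, m < (nbrs η α r ((Finset.range n).erase i) ω i).card)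
    {i j : Fin n} (hsep : i ≠ j →
      ω ∉ separatedEvent η α r D m (((Finset.range n).erase i).erase j) i j)
    (hij : toroidalDist (ω.1 i) (ω.1 j) ≤ D * r) :
    (graph η α r ((n, ω) : Sample d)).Reachable i j := by
  classical
  by_cases heq : i = j
  · subst heq; exact SimpleGraph.Reachable.refl _
  have hne : (i : ℕ) ≠ j := fun h => heq (Fin.ext h)
  by_cases hL : Linked η α r ω i j
  · exact (graph_adj_iff.2 ⟨heq, hL⟩ : (graph η α r ((n, ω) : Sample d)).Adj i j).reachable
  set S := ((Finset.range n).erase (i : ℕ)).erase j with hS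
  -- The separated event erases both endpoints from the vertex set. When they are not linked,
  -- erasing the second loses no neighbour of the first.
  have hsub : ∀ {i j : ℕ}, ¬ Linked η α r ω i j →
      nbrs η α r ((Finset.range n).erase i) ω i ⊆
        nbrs η α r (((Finset.range n).erase i).erase j) ω i := by
    intro i j h k hk
    obtain ⟨h1, h2⟩ := Finset.mem_filter.1 hk
    refine Finset.mem_filter.2 ⟨Finset.mem_erase.2 ⟨?_, h1⟩, h2⟩
    rintro rfl
    exact h h2.2
  have hmi : m ≤ (nbrs η α r S ω i).card :=
    (hdeg i i.2).le.trans (Finset.card_le_card (hsub hL))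
  have hmj : m ≤ (nbrs η α r S ω j).card := by
    rw [hS, Finset.erase_right_comm]
    exact (hdeg j j.2).le.trans (Finset.card_le_card (hsub fun h => hL h.symm))
  have hmem : ∀ {i k : ℕ}, k ∈ nbrs η α r S ω i → k < n ∧ Linked η α r ω i k ∧ k ∈ S := by
    intro i k hk
    obtain ⟨h1, h2⟩ := Finset.mem_filter.1 hk
    exact ⟨Finset.mem_range.1 (Finset.mem_of_mem_erase (Finset.mem_of_mem_erase h1)), h2.2, h1⟩
  have hadj : ∀ {i : Fin n} {k : ℕ} (hk : k ∈ nbrs η α r S ω i), k ≠ i →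
      (graph η α r ((n, ω) : Sample d)).Adj i (⟨k, (hmem hk).1⟩ : Fin n) := by
    intro i k hk hki
    refine graph_adj_iff.2 ⟨fun h => hki (by rw [h]), (hmem hk).2.1⟩
  have hSi : ∀ k ∈ S, k ≠ i := fun k hk =>
    (Finset.mem_erase.1 (Finset.mem_of_mem_erase hk)).1
  have hSj : ∀ k ∈ S, k ≠ j := fun k hk => (Finset.mem_erase.1 hk).1
  -- Disjoint neighbourhoods give a path with three edges, a common neighbour one with two.
  by_cases hdis : Disjoint (nbrs η α r S ω i) (nbrs η α r S ω j)
  · have hex : ∃ k ∈ nbrs η α r S ω i, ∃ l ∈ nbrs η α r S ω j, Linked η α r ω k l := by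
      by_contra hcon
      push Not at hcon
      exact hsep heq ⟨⟨hmi, hmj, hdis, hcon⟩, hij, hW, hpos⟩
    obtain ⟨k, hk, l, hl, hkl⟩ := hex
    have h1 := hadj hk (hSi k (hmem hk).2.2)
    have h2 := hadj hl (hSj l (hmem hl).2.2)
    have h3 : (graph η α r ((n, ω) : Sample d)).Adj (⟨k, (hmem hk).1⟩ : Fin n)
        (⟨l, (hmem hl).1⟩ : Fin n) := by
      refine graph_adj_iff.2 ⟨fun h => ?_, hkl⟩
      have : k = l := congrArg Fin.val h
      exact Finset.disjoint_left.1 hdis hk (this ▸ hl)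
    exact h1.reachable.trans (h3.reachable.trans h2.reachable.symm)
  · obtain ⟨k, hk, hk'⟩ := Finset.not_disjoint_iff.1 hdis
    exact (hadj hk (hSi k (hmem hk).2.2)).reachable.trans
      (hadj hk' (hSj k (hmem hk).2.2)).reachable.symm

/-- Bound for the probability that the graph on `n` vertices is disconnected. -/
lemma measure_disconnected_le {η α β r θ D : ℝ} (hd : 0 < d) (hη : 0 < η) (hα : 0 < α)
    (hβ : 0 < β) (hr0 : 0 < r) (hr : r ≤ 1 / 2) (hθ0 : 0 < θ) (hθ1 : θ < 1) (hD : 0 ≤ D)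
    (m n : ℕ) {l : ℕ} (hl : 0 < l) (hlD : 2 * d / l ≤ D * r) :
    configMeasure d β hβ {ω | ¬ (graph η α r ((n, ω) : Sample d)).Connected} ≤
      n * ((ENNReal.ofReal θ ^ m)⁻¹ *
        ENNReal.ofReal (1 - (1 - θ) * (kappa d η α β * r ^ d)) ^ (n - 1)) +
      (n * (n - 1) : ℕ) * ENNReal.ofReal (Real.exp (-(η / (D + 2) ^ α))) ^ (m * m) +
      (l ^ d : ℕ) * ENNReal.ofReal (1 - (1 / (l : ℝ)) ^ d) ^ n := by
  classical
  set P := configMeasure d β hβ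
  set A : ℕ → Set (Config d) := fun i =>
    {ω | 1 ≤ ω.2.1 i ∧ (nbrs η α r ((Finset.range n).erase i) ω i).card ≤ m}
  set B : ℕ × ℕ → Set (Config d) := fun q =>
    separatedEvent η α r D m (((Finset.range n).erase q.1).erase q.2) q.1 q.2
  set C : (Fin d → Fin l) → Set (Config d) := fun c =>
    {ω | ∀ k < n, ω.1 k ∉ cell l fun i => (c i : ℕ)}
  -- Almost surely, disconnection needs a vertex of low degree (`A`), a separated pair (`B`) or an
  -- empty cell (`C`).
  have hsub : ∀ᵐ ω ∂P, ω ∈ {ω | ¬ (graph η α r ((n, ω) : Sample d)).Connected} →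
      ω ∈ ((⋃ i ∈ Finset.range n, A i) ∪ ⋃ q ∈ (Finset.range n).offDiag, B q) ∪
        ⋃ c ∈ (Finset.univ : Finset (Fin d → Fin l)), C c := by
    filter_upwards [ae_weights (d := d) hβ, ae_points (d := d) hβ,
      ae_toroidalDist_pos (d := d) hd hβ] with ω hW hX hpos hcon
    by_contra hnot
    refine hcon ?_
    simp only [mem_union, mem_iUnion, not_or, not_exists] at hnot
    obtain ⟨⟨hA, hB⟩, hC⟩ := hnot
    refine connected_of_occupied_cells hl _ ω.1 hX (fun i j hij => ?_) fun c hc => ?_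
    · refine reachable_of_notMem_separatedEvent (m := m) (D := D) hW hpos (fun i hi => ?_)
        (fun hne => ?_) (hij.trans hlD)
      · by_contra hlt
        exact hA i (Finset.mem_range.2 hi) ⟨hW i, not_lt.1 hlt⟩
      · exact hB (i, j) (Finset.mem_offDiag.2 ⟨Finset.mem_range.2 i.2, Finset.mem_range.2 j.2,
          fun h => hne (Fin.ext h)⟩)
    · have := hC (fun i => ⟨c i, hc i⟩) (Finset.mem_univ _)
      simp only [C, mem_ofPred_eq] at this
      push Not at this
      obtain ⟨k, hk, hkc⟩ := this
      exact ⟨⟨k, hk⟩, hkc⟩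
  refine (measure_mono_ae hsub).trans ((measure_union_le _ _).trans
    (add_le_add ((measure_union_le _ _).trans (add_le_add ?_ ?_)) ?_))
  · refine (measure_biUnion_finset_le _ _).trans ?_
    calc ∑ i ∈ Finset.range n, P (A i) ≤ ∑ i ∈ Finset.range n, ((ENNReal.ofReal θ ^ m)⁻¹ *
        ENNReal.ofReal (1 - (1 - θ) * (kappa d η α β * r ^ d)) ^ (n - 1)) := by
          refine Finset.sum_le_sum fun i hi => ?_
          have h := measure_few_nbrs_le (d := d) hd hη hα hβ hr0 hr hθ0 hθ1 m i
            ((Finset.range n).erase i) (Finset.notMem_erase _ _)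
          rw [Finset.card_erase_of_mem hi, Finset.card_range] at h
          rw [mul_comm, ← div_eq_mul_inv]
          refine (ENNReal.le_div_iff_mul_le (Or.inl ?_) (Or.inl ?_)).2 ?_
          · exact pow_ne_zero _ (by simpa using hθ0)
          · exact ENNReal.pow_ne_top ENNReal.ofReal_ne_top
          · rw [mul_comm]; exact h
      _ = _ := by simp
  · refine (measure_biUnion_finset_le _ _).trans ?_
    calc ∑ q ∈ (Finset.range n).offDiag, P (B q) ≤ ∑ q ∈ (Finset.range n).offDiag,
        ENNReal.ofReal (Real.exp (-(η / (D + 2) ^ α))) ^ (m * m) := by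
          refine Finset.sum_le_sum fun q _ => ?_
          refine measure_separatedEvent_le hη hα hr0 hβ hD m q.1 q.2 _ ?_ ?_
          · exact fun h => Finset.notMem_erase _ _ (Finset.mem_of_mem_erase h)
          · exact Finset.notMem_erase _ _
      _ = _ := by
          rw [Finset.sum_const, Finset.offDiag_card, Finset.card_range, nsmul_eq_mul,
            Nat.mul_sub_one]
  · refine (measure_biUnion_finset_le _ _).trans ?_
    calc ∑ c ∈ (Finset.univ : Finset (Fin d → Fin l)), P (C c)
        = ∑ c ∈ (Finset.univ : Finset (Fin d → Fin l)),
          ENNReal.ofReal (1 - (1 / (l : ℝ)) ^ d) ^ n :=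
          Finset.sum_congr rfl fun c _ => measure_cell_empty hβ n hl fun i => (c i).2
      _ ≤ _ := by simp

end FixedSize

/-! ### Poisson averages of the bounds for fixed size. -/

section PoissonSums

/-- A sum is unchanged when its terms and its value are rewritten. -/
lemma hasSum_of_eq {f g : ℕ → ℝ} {a b : ℝ} (h : HasSum f a) (hfg : ∀ n, g n = f n) (hab : b = a) :
    HasSum g b := by
  rw [hab, funext hfg]
  exact h

lemma hasSum_poisson_mul_pow (s c : ℝ) :
    HasSum (fun n : ℕ => Real.exp (-s) * s ^ n / n.factorial * c ^ n) (Real.exp (s * (c - 1))) := by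
  have h := (NormedSpace.expSeries_div_hasSum_exp (s * c)).mul_left (Real.exp (-s))
  rw [← Real.exp_eq_exp_ℝ, ← Real.exp_add] at h
  exact hasSum_of_eq h (fun n => by rw [mul_pow]; ring) (by congr 1; ring)

/-- The term `n = 0` vanishes, and after an index shift `n + 1` cancels against the factorial,
leaving `s` times the generating function. -/
lemma hasSum_poisson_mul_nat_mul_pow (s c : ℝ) :
    HasSum (fun n : ℕ => Real.exp (-s) * s ^ n / n.factorial * (n * c ^ (n - 1)))
      (s * Real.exp (s * (c - 1))) := by
  rw [← hasSum_nat_add_iff' 1]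
  simp only [Finset.range_one, Finset.sum_singleton, Nat.cast_zero, zero_mul, mul_zero, sub_zero]
  refine hasSum_of_eq ((hasSum_poisson_mul_pow s c).mul_left s) (fun n => ?_) rfl
  rw [Nat.factorial_succ, Nat.add_sub_cancel, Nat.cast_mul, pow_succ]
  have h1 : ((n + 1 : ℕ) : ℝ) ≠ 0 := by positivity
  have h2 : (n.factorial : ℝ) ≠ 0 := by positivity
  field_simp

/-- The second factorial moment, by the same shift from the previous sum at `c = 1`. -/
lemma hasSum_poisson_mul_pairs (s : ℝ) :
    HasSum (fun n : ℕ => Real.exp (-s) * s ^ n / n.factorial * ((n * (n - 1) : ℕ) : ℝ))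
      (s ^ 2) := by
  rw [← hasSum_nat_add_iff' 1]
  simp only [Finset.range_one, Finset.sum_singleton, zero_mul, Nat.cast_zero, mul_zero, sub_zero]
  have h := (hasSum_poisson_mul_nat_mul_pow s 1).mul_left s
  simp only [sub_self, mul_zero, Real.exp_zero, mul_one, one_pow] at h
  refine hasSum_of_eq h (fun n => ?_) (sq s)
  rw [Nat.factorial_succ, Nat.add_sub_cancel, Nat.cast_mul, Nat.cast_mul, pow_succ]
  have h1 : ((n + 1 : ℕ) : ℝ) ≠ 0 := by positivity
  have h2 : (n.factorial : ℝ) ≠ 0 := by positivity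
  field_simp

lemma tsum_poisson_ofReal {s : ℝ} (hs : 0 ≤ s) {f : ℕ → ℝ} (hf : ∀ n, 0 ≤ f n) {a : ℝ}
    (h : HasSum (fun n : ℕ => Real.exp (-s) * s ^ n / n.factorial * f n) a) :
    ∑' n, poissonMeasure s.toNNReal {n} * ENNReal.ofReal (f n) = ENNReal.ofReal a := by
  rw [← h.tsum_eq, ENNReal.ofReal_tsum_of_nonneg (fun n => mul_nonneg (by positivity) (hf n))
    h.summable]
  refine tsum_congr fun n => ?_
  rw [poissonMeasure_singleton, Real.coe_toNNReal s hs, ← ENNReal.ofReal_mul (by positivity)]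

end PoissonSums

/-! ### The disconnection bound at Poisson size. -/

section Disconnected

variable {d : ℕ}

/-- Bound for the probability that the random graph is disconnected. -/
lemma modelMeasure_disconnected_le {η α β r θ D s : ℝ} (hd : 0 < d) (hη : 0 < η) (hα : 0 < α)
    (hβ : 0 < β) (hs : 0 ≤ s) (hr0 : 0 < r) (hr : r ≤ 1 / 2) (hθ0 : 0 < θ) (hθ1 : θ < 1)
    (hD : 0 ≤ D) (hκ : (1 - θ) * (kappa d η α β * r ^ d) ≤ 1)
    (m : ℕ) {l : ℕ} (hl : 0 < l) (hlD : 2 * d / l ≤ D * r) :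
    modelMeasure d β hβ s {ω | ¬ (graph η α r ω).Connected} ≤
      ENNReal.ofReal ((θ ^ m)⁻¹ * (s * Real.exp (-(s * ((1 - θ) * (kappa d η α β * r ^ d))))) +
        s ^ 2 * Real.exp (-(η / (D + 2) ^ α)) ^ (m * m) +
        (l : ℝ) ^ d * Real.exp (-(s * (1 / (l : ℝ)) ^ d))) := by
  set b := (1 - θ) * (kappa d η α β * r ^ d)
  set p := Real.exp (-(η / (D + 2) ^ α))
  set v := (1 / (l : ℝ)) ^ d
  have hv : v ≤ 1 := by
    refine pow_le_one₀ (by positivity) ?_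
    rw [div_le_one (by exact_mod_cast hl)]
    exact_mod_cast hl
  set P := configMeasure d β hβ
  have hset : {ω : Sample d | ¬ (graph η α r ω).Connected} =
      ⋃ n : ℕ, ({n} : Set ℕ) ×ˢ {ω : Config d | ¬ (graph η α r ((n, ω) : Sample d)).Connected} := by
    ext ⟨n, ω⟩
    simp
  -- The bases `1 - b` and `1 - v` are nonnegative, so the bound can be moved to real numbers and
  -- summed there.
  have hone : ∀ n : ℕ, P {ω : Config d | ¬ (graph η α r ((n, ω) : Sample d)).Connected} ≤
      ENNReal.ofReal ((θ ^ m)⁻¹ * (n * (1 - b) ^ (n - 1))) +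
        ENNReal.ofReal (((n * (n - 1) : ℕ) : ℝ) * p ^ (m * m)) +
        ENNReal.ofReal ((l : ℝ) ^ d * (1 - v) ^ n) := by
    intro n
    refine (measure_disconnected_le hd hη hα hβ hr0 hr hθ0 hθ1 hD m n hl hlD).trans_eq ?_
    congr 1
    · congr 1
      · rw [ENNReal.ofReal_mul (by positivity), ENNReal.ofReal_mul (by positivity),
          ENNReal.ofReal_inv_of_pos (by positivity), ENNReal.ofReal_pow hθ0.le,
          ENNReal.ofReal_pow (by linarith), ENNReal.ofReal_natCast]
        ring
      · rw [ENNReal.ofReal_mul (by positivity), ENNReal.ofReal_natCast,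
          ENNReal.ofReal_pow (by positivity)]
    · rw [ENNReal.ofReal_mul (by positivity), ← Nat.cast_pow, ENNReal.ofReal_natCast,
        ENNReal.ofReal_pow (by linarith)]
  have hsum1 := tsum_poisson_ofReal hs (f := fun n => (θ ^ m)⁻¹ * (n * (1 - b) ^ (n - 1)))
    (fun n => by
      have : 0 ≤ (1 - b) ^ (n - 1) := pow_nonneg (by linarith) _
      positivity)
    (a := (θ ^ m)⁻¹ * (s * Real.exp (-(s * b)))) (hasSum_of_eq ((hasSum_poisson_mul_nat_mul_pow s (1 - b)).mul_left ((θ ^ m)⁻¹))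
      (fun n => by ring) (by congr 3; ring))
  have hsum2 := tsum_poisson_ofReal hs (f := fun n => ((n * (n - 1) : ℕ) : ℝ) * p ^ (m * m))
    (fun n => by positivity) (a := s ^ 2 * p ^ (m * m)) (hasSum_of_eq ((hasSum_poisson_mul_pairs s).mul_right (p ^ (m * m)))
      (fun n => by ring) rfl)
  have hsum3 := tsum_poisson_ofReal hs (f := fun n => (l : ℝ) ^ d * (1 - v) ^ n)
    (fun n => mul_nonneg (by positivity) (pow_nonneg (by linarith) _))
    (a := (l : ℝ) ^ d * Real.exp (-(s * v))) (hasSum_of_eq ((hasSum_poisson_mul_pow s (1 - v)).mul_left ((l : ℝ) ^ d))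
      (fun n => by ring) (by congr 2; ring))
  calc modelMeasure d β hβ s {ω | ¬ (graph η α r ω).Connected}
      ≤ ∑' n, modelMeasure d β hβ s (({n} : Set ℕ) ×ˢ
          {ω : Config d | ¬ (graph η α r ((n, ω) : Sample d)).Connected}) := by
        rw [hset]; exact measure_iUnion_le _
    _ = ∑' n, poissonMeasure s.toNNReal {n} *
          P {ω : Config d | ¬ (graph η α r ((n, ω) : Sample d)).Connected} :=
        tsum_congr fun n => Measure.prod_prod (μ := poissonMeasure s.toNNReal) (ν := P) _ _
    _ ≤ ∑' n, poissonMeasure s.toNNReal {n} *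
          (ENNReal.ofReal ((θ ^ m)⁻¹ * (n * (1 - b) ^ (n - 1))) +
          ENNReal.ofReal (((n * (n - 1) : ℕ) : ℝ) * p ^ (m * m)) +
          ENNReal.ofReal ((l : ℝ) ^ d * (1 - v) ^ n)) :=
        ENNReal.tsum_le_tsum fun n => mul_le_mul_right (hone n) _
    _ = _ := by
        simp_rw [mul_add]
        rw [ENNReal.tsum_add, ENNReal.tsum_add, hsum1, hsum2, hsum3,
          ENNReal.ofReal_add (by positivity) (by positivity),
          ENNReal.ofReal_add (by positivity) (by positivity)]

end Disconnected

/-! ### The threshold `ρ`: existence, uniqueness and `ρ > 1`. -/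

section Threshold

variable {d : ℕ} {η α β : ℝ}

lemma ballVolume_pos (d : ℕ) : 0 < ballVolume d :=
  ENNReal.toReal_pos (Metric.measure_ball_pos volume _ one_pos).ne' measure_ball_lt_top.ne

lemma T_pos (hη : 0 < η) (hκ : 0 < kappa d η α β) {γ : ℝ} (hγ : 0 < γ) : 0 < T d η α β γ := by
  have := ballVolume_pos d
  unfold T
  rw [sub_pos, Real.exp_lt_one_iff, neg_lt_zero]
  positivity

lemma T_lt_one (γ : ℝ) : T d η α β γ < 1 := by
  unfold T
  linarith [Real.exp_pos (-(η * (1 + (kappa d η α β / (γ * ballVolume d)) ^ (1 / (d : ℝ))) ^ (-α)))]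

/-- Increasing `γ` shrinks `κ / (γ θ_d)`, and the negative exponent `-α` reverses the order. -/
lemma T_mono (hη : 0 < η) (hα : 0 < α) (hκ : 0 < kappa d η α β) {γ γ' : ℝ} (hγ : 0 < γ)
    (h : γ ≤ γ') : T d η α β γ ≤ T d η α β γ' := by
  have hb := ballVolume_pos d
  have hγ' : 0 < γ' := hγ.trans_le h
  have h1 : (kappa d η α β / (γ' * ballVolume d)) ^ (1 / (d : ℝ)) ≤
      (kappa d η α β / (γ * ballVolume d)) ^ (1 / (d : ℝ)) := by
    refine Real.rpow_le_rpow (by positivity) ?_ (by positivity)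
    gcongr
  have h2 : (1 + (kappa d η α β / (γ * ballVolume d)) ^ (1 / (d : ℝ))) ^ (-α) ≤
      (1 + (kappa d η α β / (γ' * ballVolume d)) ^ (1 / (d : ℝ))) ^ (-α) :=
    Real.rpow_le_rpow_of_nonpos (by positivity) (by linarith) (by linarith)
  have h3 := Real.exp_le_exp.2 (neg_le_neg (mul_le_mul_of_nonneg_left h2 hη.le))
  unfold T
  linarith

lemma Q_strictMono (hη : 0 < η) (hα : 0 < α) (hκ : 0 < kappa d η α β) {γ γ' : ℝ} (hγ : 0 < γ)
    (h : γ < γ') : Q d η α β γ < Q d η α β γ' := by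
  have h1 := T_mono (β := β) hη hα hκ hγ h.le
  have h2 := T_pos (β := β) hη hκ hγ
  unfold Q
  nlinarith

lemma continuousOn_Q (hκ : 0 < kappa d η α β) : ContinuousOn (Q d η α β) (Ioi 0) := by
  have hb := ballVolume_pos d
  unfold Q T
  refine continuousOn_id.mul (continuousOn_const.sub (Real.continuous_exp.comp_continuousOn
    (ContinuousOn.neg (continuousOn_const.mul (ContinuousOn.rpow_const (continuousOn_const.add
      (ContinuousOn.rpow_const (continuousOn_const.div (by fun_prop) ?_) ?_)) ?_)))))
  · intro x hx
    have : 0 < x := hx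
    positivity
  · intro x hx
    have : 0 < x := hx
    exact Or.inl (by positivity)
  · intro x hx
    have : 0 < x := hx
    exact Or.inl (by positivity)

lemma existsUnique_Q_eq_one (hη : 0 < η) (hα : 0 < α) (hκ : 0 < kappa d η α β) :
    ∃! ρ : ℝ, 0 < ρ ∧ Q d η α β ρ = 1 := by
  have hT := T_pos (β := β) hη hκ one_pos
  have hT1 := T_lt_one (d := d) (η := η) (α := α) (β := β) 1
  -- With this `b`, `Q 1 = T 1 ≤ 1` and, by monotonicity of `T`, `Q b ≥ b * T 1 = 1`; the
  -- intermediate value theorem applies on `[1, b]`.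
  set b := 1 / T d η α β 1
  have hb : 1 ≤ b := by rw [le_div_iff₀ hT]; linarith
  have hlo : Q d η α β 1 ≤ 1 := by unfold Q; linarith
  have hhi : 1 ≤ Q d η α β b := by
    have h1 := T_mono (β := β) hη hα hκ one_pos hb
    have h2 : b * T d η α β 1 = 1 := by simp only [b]; field_simp
    unfold Q
    nlinarith
  obtain ⟨ρ, hρ, hQ⟩ := intermediate_value_Icc hb
    ((continuousOn_Q hκ).mono fun x hx => zero_lt_one.trans_le hx.1) ⟨hlo, hhi⟩
  refine ⟨ρ, ⟨zero_lt_one.trans_le hρ.1, hQ⟩, fun ρ' hρ' => ?_⟩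
  have hρ0 : 0 < ρ := zero_lt_one.trans_le hρ.1
  rcases lt_trichotomy ρ' ρ with h | h | h
  · exact absurd (Q_strictMono (β := β) hη hα hκ hρ'.1 h) (by rw [hQ, hρ'.2]; exact lt_irrefl _)
  · exact h
  · exact absurd (Q_strictMono (β := β) hη hα hκ hρ0 h) (by rw [hQ, hρ'.2]; exact lt_irrefl _)

/-- From `ρ T(ρ) = 1` and `T(ρ) < 1`. This puts every `γ` above the threshold in the range where
degrees are large. -/
lemma one_lt_of_Q_eq_one {ρ : ℝ} (hρ : 0 < ρ) (h : Q d η α β ρ = 1) : 1 < ρ := by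
  have := T_lt_one (d := d) (η := η) (α := α) (β := β) ρ
  unfold Q at h
  nlinarith

end Threshold

/-! ### Choice of constants and the limit as `s` tends to infinity. -/

section Asymptotics

variable {d : ℕ} {η α β γ : ℝ}

lemma rHat_pos (hκ : 0 < kappa d η α β) (hγ : 0 < γ) {s : ℝ} (hs : 1 < s) :
    0 < rHat d η α β γ s := by
  have := Real.log_pos hs
  unfold rHat
  positivity

lemma rHat_pow (hd : 0 < d) (hκ : 0 < kappa d η α β) (hγ : 0 < γ) {s : ℝ} (hs : 1 < s) :
    rHat d η α β γ s ^ d = γ * Real.log s / (kappa d η α β * s) := by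
  have := Real.log_pos hs
  unfold rHat
  rw [← Real.rpow_natCast, ← Real.rpow_mul (by positivity), one_div_mul_cancel (by positivity),
    Real.rpow_one]

lemma tendsto_log_div_atTop : Tendsto (fun s : ℝ => Real.log s / s) atTop (𝓝 0) :=
  Real.isLittleO_log_id_atTop.tendsto_div_nhds_zero

lemma tendsto_rHat (hd : 0 < d) :
    Tendsto (rHat d η α β γ) atTop (𝓝 0) := by
  have hd' : 0 < 1 / (d : ℝ) := by positivity
  have h1 : Tendsto (fun s : ℝ => γ * Real.log s / (kappa d η α β * s)) atTop (𝓝 0) := by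
    have := tendsto_log_div_atTop.const_mul (γ / kappa d η α β)
    rw [mul_zero] at this
    refine this.congr fun s => ?_
    rw [div_mul_div_comm]
  have h2 := h1.rpow_const (p := 1 / (d : ℝ)) (Or.inr hd'.le)
  rwa [Real.zero_rpow hd'.ne'] at h2

/-- The vertex count and the degree bound leave the exponent `-(γ - 1) / 2 * L`; by the choice of
`δ`, the Markov factor uses up half of it, and rounding up costs one more `θ⁻¹`. -/
lemma inv_pow_ceil_mul_exp_le {θ δ L : ℝ} (hθ0 : 0 < θ) (hθ1 : θ < 1) (hδ : 0 ≤ δ) (hL : 0 ≤ L)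
    (h : δ * -Real.log θ = (γ - 1) / 4) :
    (θ ^ ⌈δ * L⌉₊)⁻¹ * (Real.exp L * Real.exp (-((γ + 1) / 2 * L))) ≤
      θ⁻¹ * Real.exp (-((γ - 1) / 4 * L)) := by
  have hlog : Real.log θ < 0 := Real.log_neg hθ0 hθ1
  have e1 : θ⁻¹ = Real.exp (-Real.log θ) := by rw [Real.exp_neg, Real.exp_log hθ0]
  have hm : (⌈δ * L⌉₊ : ℝ) ≤ δ * L + 1 := (Nat.ceil_lt_add_one (by positivity)).le
  have h1 := mul_le_mul_of_nonneg_right hm (neg_nonneg.2 hlog.le)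
  have h2 : (δ * L + 1) * -Real.log θ = (γ - 1) / 4 * L + -Real.log θ := by rw [← h]; ring
  rw [← inv_pow, e1, ← Real.exp_nat_mul, ← Real.exp_add, ← Real.exp_add, ← Real.exp_add]
  refine Real.exp_le_exp.2 ?_
  linarith

lemma exp_sq_mul_exp_pow_le {q δ L : ℝ} {m : ℕ} (hq : 0 ≤ q) (hδL : 0 ≤ δ * L) (hm : δ * L ≤ m) :
    Real.exp L ^ 2 * Real.exp (-q) ^ (m * m) ≤ Real.exp (-((q * δ ^ 2 * L - 2) * L)) := by
  have h3 := mul_le_mul_of_nonneg_left (mul_le_mul hm hm hδL (Nat.cast_nonneg m)) hq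
  have h4 : -((q * δ ^ 2 * L - 2) * L) = 2 * L - q * (δ * L * (δ * L)) := by ring
  rw [← Real.exp_nat_mul, ← Real.exp_nat_mul, ← Real.exp_add, h4]
  refine Real.exp_le_exp.2 ?_
  push_cast
  linarith

/-- Cells of side at least `a` have mean occupancy at least `2 L`, and there are at most `s` of
them. -/
lemma pow_mul_exp_neg_le {l : ℕ} (hl : 0 < l) {a L s : ℝ} (ha : 0 < a) (hla : (l : ℝ) ≤ 1 / a)
    (hL : 1 ≤ L) (hs : 0 < s) (had : a ^ d = 2 * L / s) :
    (l : ℝ) ^ d * Real.exp (-(s * (1 / (l : ℝ)) ^ d)) ≤ s * Real.exp (-(2 * L)) := by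
  have hl' : (0 : ℝ) < l := by exact_mod_cast hl
  have h1 : (l : ℝ) ^ d ≤ s := by
    calc (l : ℝ) ^ d ≤ (1 / a) ^ d := by gcongr
      _ = s / (2 * L) := by rw [div_pow, one_pow, had, one_div_div]
      _ ≤ s := by rw [div_le_iff₀ (by linarith)]; nlinarith
  have h2 : 2 * L ≤ s * (1 / (l : ℝ)) ^ d := by
    have : a ≤ 1 / l := by
      rw [le_div_iff₀ hl']
      rwa [le_div_iff₀ ha, mul_comm] at hla
    calc 2 * L = s * a ^ d := by rw [had]; field_simp
      _ ≤ _ := by gcongr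
  gcongr

/-- Above the threshold, the probability of being disconnected is explicitly bounded. -/
lemma exists_eventually_modelMeasure_disconnected_le (hd : 0 < d) (hη : 0 < η) (hα : 0 < α)
    (hβ : 0 < β) (hγ : 1 < γ) : ∃ θ q : ℝ, 0 < q ∧
    ∀ᶠ s : ℝ in atTop, modelMeasure d β hβ s
      {ω | ¬ (graph η α (rHat d η α β γ s) ω).Connected} ≤
      ENNReal.ofReal (θ⁻¹ * Real.exp (-((γ - 1) / 4 * Real.log s)) +
        Real.exp (-((q * Real.log s - 2) * Real.log s)) +
        Real.exp (-Real.log s)) := by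
  have hκ := kappa_pos hη hα hβ hd
  set κ := kappa d η α β with hκdef
  have hγ0 : 0 < γ := by linarith
  -- Chosen so that `(1 - θ) γ` is the midpoint of `1` and `γ`, in particular still above one.
  set θ := (γ - 1) / (2 * γ) with hθ
  have hθ0 : 0 < θ := div_pos (by linarith) (by linarith)
  have hθ1 : θ < 1 := by rw [hθ, div_lt_one (by linarith)]; linarith
  have hθγ : (1 - θ) * γ = (γ + 1) / 2 := by rw [hθ]; field_simp; ring
  set τ := -Real.log θ with hτ
  have hτ0 : 0 < τ := by rw [hτ, neg_pos]; exact Real.log_neg hθ0 hθ1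
  -- Then `θ ^ (-δ L) = exp ((γ - 1) / 4 * L)`, half of the available exponent `(γ - 1) / 2`.
  set δ := (γ - 1) / (4 * τ) with hδ
  have hδ0 : 0 < δ := div_pos (by linarith) (by linarith)
  -- Chosen so that a cube of side `lam * r` has mean occupancy exactly `2 L`.
  set lam := (2 * κ / γ) ^ (1 / (d : ℝ)) with hlam
  have hlam0 : 0 < lam := by positivity
  have hlampow : lam ^ d = 2 * κ / γ := by
    rw [hlam, ← Real.rpow_natCast, ← Real.rpow_mul (by positivity),
      one_div_mul_cancel (by positivity), Real.rpow_one]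
  -- Rounding `1 / a` down at most doubles the side, so `1 / l ≤ 2 * lam * r` and points of adjacent
  -- cells are within `2 d / l ≤ D r`.
  set D := 4 * d * lam with hD
  have hD0 : 0 ≤ D := by positivity
  set q := η / (D + 2) ^ α with hq
  have hq0 : 0 < q := by positivity
  refine ⟨θ, q * δ ^ 2, by positivity, ?_⟩
  have hr := tendsto_rHat (d := d) (η := η) (α := α) (β := β) (γ := γ) hd
  have hr' := hr.const_mul lam
  rw [mul_zero] at hr'
  -- Eventually `(1 - θ) κ r ^ d ≤ 1`, which keeps the base of the degree bound nonnegative.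
  have hlog := tendsto_log_div_atTop.const_mul ((1 - θ) * γ)
  rw [mul_zero] at hlog
  filter_upwards [eventually_gt_atTop 1, Real.tendsto_log_atTop.eventually_ge_atTop 1,
    hr.eventually_le_const (show (0 : ℝ) < 1 / 2 by norm_num),
    hr'.eventually_le_const one_pos, hlog.eventually_le_const one_pos] with s hs hL hr2 ha hb
  set r := rHat d η α β γ s
  have hs0 : 0 < s := by linarith
  have hr0 : 0 < r := rHat_pos hκ hγ0 hs
  have hrd : r ^ d = γ * Real.log s / (κ * s) := rHat_pow hd hκ hγ0 hs
  set L := Real.log s with hLdef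
  have hexpL : Real.exp L = s := Real.exp_log hs0
  set a := lam * r with hadef
  have ha0 : 0 < a := by positivity
  have had : a ^ d = 2 * L / s := by
    rw [hadef, mul_pow, hlampow, hrd]; field_simp
  set l := ⌊1 / a⌋₊ with hldef
  have h1a : 1 ≤ 1 / a := by rw [le_div_iff₀ ha0]; linarith
  have hl : 0 < l := Nat.floor_pos.2 h1a
  have hl' : (0 : ℝ) < l := by exact_mod_cast hl
  have hl1 : (l : ℝ) ≤ 1 / a := Nat.floor_le (by positivity)
  have hl2 : 1 / a ≤ 2 * l := by
    have h1 := Nat.lt_floor_add_one (1 / a)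
    have h2 : (1 : ℝ) ≤ l := by exact_mod_cast hl
    linarith
  have hlD : 2 * d / l ≤ D * r := by
    rw [div_le_iff₀ hl']
    have h1 : 1 ≤ 2 * l * a := by rwa [div_le_iff₀ ha0] at hl2
    have h2 : D * r * l = 2 * d * (2 * l * a) := by rw [hD, hadef]; ring
    rw [h2]
    have : (0 : ℝ) ≤ 2 * d := by positivity
    nlinarith
  have hκr : κ * r ^ d = γ * L / s := by rw [hrd]; field_simp
  have hκ1 : (1 - θ) * (κ * r ^ d) ≤ 1 := by
    rw [hκr, mul_div_assoc, ← mul_assoc]; exact hb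
  set m := ⌈δ * L⌉₊
  refine (modelMeasure_disconnected_le hd hη hα hβ hs0.le hr0 hr2 hθ0 hθ1 hD0 hκ1 m hl
    hlD).trans (ENNReal.ofReal_le_ofReal (add_le_add (add_le_add ?_ ?_) ?_))
  · have h1 : s * ((1 - θ) * (κ * r ^ d)) = (γ + 1) / 2 * L := by
      rw [hκr, ← hθγ]; field_simp
    rw [h1]
    nth_rw 1 [← hexpL]
    exact inv_pow_ceil_mul_exp_le hθ0 hθ1 hδ0.le (zero_le_one.trans hL)
      (by rw [← hτ, hδ]; field_simp)
  · nth_rw 1 [← hexpL]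
    exact exp_sq_mul_exp_pow_le hq0.le (by positivity) (Nat.le_ceil _)
  · refine (pow_mul_exp_neg_le hl ha0 hl1 hL hs0 had).trans_eq ?_
    nth_rw 1 [← hexpL]
    rw [← Real.exp_add]
    congr 1
    ring

/-- Above the threshold the probability of being disconnected tends to zero. -/
lemma tendsto_modelMeasure_disconnected (hd : 0 < d) (hη : 0 < η) (hα : 0 < α) (hβ : 0 < β)
    (hγ : 1 < γ) :
    Tendsto (fun s : ℝ => modelMeasure d β hβ s
      {ω | ¬ (graph η α (rHat d η α β γ s) ω).Connected}) atTop (𝓝 0) := by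
  obtain ⟨θ, q, hq, hbound⟩ :=
    exists_eventually_modelMeasure_disconnected_le hd hη hα hβ hγ
  have hlim : Tendsto (fun s : ℝ => ENNReal.ofReal (θ⁻¹ * Real.exp (-((γ - 1) / 4 * Real.log s)) +
        Real.exp (-((q * Real.log s - 2) * Real.log s)) +
        Real.exp (-Real.log s))) atTop (𝓝 0) := by
    have hlog := Real.tendsto_log_atTop
    have h1 := (Real.tendsto_exp_neg_atTop_nhds_zero.comp
      (hlog.const_mul_atTop (show 0 < (γ - 1) / 4 by linarith))).const_mul θ⁻¹
    have h2 := Real.tendsto_exp_neg_atTop_nhds_zero.comp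
      (((tendsto_atTop_add_const_right _ (-2 : ℝ)
        (hlog.const_mul_atTop hq))).atTop_mul_atTop₀ hlog)
    have h3 := Real.tendsto_exp_neg_atTop_nhds_zero.comp hlog
    have h := ENNReal.tendsto_ofReal ((h1.add h2).add h3)
    simp only [mul_zero, add_zero, ENNReal.ofReal_zero] at h
    refine h.congr fun s => ?_
    simp only [Function.comp_apply, sub_eq_add_neg]
  exact tendsto_of_tendsto_of_tendsto_of_le_of_le' tendsto_const_nhds hlim
    (Eventually.of_forall fun _ => zero_le) hbound

end Asymptotics

end

end RandomConnection

/-! ### The main theorem. -/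

open RandomConnection in
theorem theorem3p3 (d : ℕ) (hd : 2 ≤ d) (η α β : ℝ) (hη : 0 < η) (hα : (d : ℝ) < α)
    (hβ : 1 < β) :
    (∃! ρ : ℝ, 0 < ρ ∧ RandomConnection.Q d η α β ρ = 1) ∧
      ∀ ρ : ℝ, 0 < ρ → RandomConnection.Q d η α β ρ = 1 → ∀ γ : ℝ, ρ < γ →
        Tendsto
          (fun s : ℝ => RandomConnection.modelMeasure d β (zero_lt_one.trans hβ) s
            {ω | (RandomConnection.graph η α
              (RandomConnection.rHat d η α β γ s) ω).Connected})
          atTop (𝓝 1) := by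
  have hd0 : 0 < d := by omega
  have hα0 : 0 < α := (Nat.cast_nonneg d).trans_lt hα
  have hβ0 : 0 < β := zero_lt_one.trans hβ
  refine ⟨existsUnique_Q_eq_one hη hα0 (kappa_pos hη hα0 hβ0 hd0), fun ρ hρ hQ γ hγ => ?_⟩
  -- The threshold enters through `γ > ρ > 1`.
  have h := tendsto_modelMeasure_disconnected hd0 hη hα0 hβ0
    ((one_lt_of_Q_eq_one hρ hQ).trans hγ)
  have h1 := ENNReal.Tendsto.sub (tendsto_const_nhds (x := (1 : ℝ≥0∞))) h
    (Or.inl ENNReal.one_ne_top)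
  rw [tsub_zero] at h1
  refine h1.congr fun s => ?_
  have h2 := prob_compl_eq_one_sub (μ := modelMeasure d β hβ0 s)
    (measurableSet_connected (d := d) η α (rHat d η α β γ s)).compl
  rw [compl_compl] at h2
  exact h2.symm
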